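/- Let $N,M$ be natural numbers and $j=\sqrt{-1}$. Let $\lambda>0$ (wavelength), $\sigma>0$ (noise power $\sigma^2$), $\beta_m>0$ (path losses), $K_m\ge 0$ (Rician factors) and real angles $\theta_m,\varphi_m$ be given for $m=1,\dots,M$, let $\boldsymbol\rho_m=(\sin\theta_m\cos\varphi_m,\cos\theta_m)^{\mathrm T}$, and let $\mathbf F\in\mathbb C^{N\times M}$, $\mathbf F\neq 0$, have columns $\mathbf f_1,\dots,\mathbf f_M$. For antenna positions $\mathbf T=[\mathbf t_1,\dots,\mathbf t_N]$, $\mathbf t_n\in\mathbb R^2$, let $\mathbf G_{\mathrm{LoS}}\in\mathbb C^{N\times M}$ have entries $e^{j\frac{2\pi}{\lambda}\mathbf t_n^{\mathrm T}\boldsymbol\rho_m}$, and put $$\mathbf\Lambda=\mathrm{diag}\Big(\tfrac{K_m\beta_m}{K_m+1}\Big),\quad \mathbf B=\mathbf\Lambda^{1/2}\mathbf G_{\mathrm{LoS}}^{\mathrm H}\mathbf F,\quad \mathbf D=\mathrm{diag}\Big(\tfrac{M\beta_m}{K_m+1}\Big),\quad \widetilde{\mathbf D}=\mathrm{diag}(\|\mathbf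 f_k\|^2).$$ For every $\mathbf T$ the system $\delta=\frac1M\mathrm{tr}(\mathbf D\mathbf\Gamma)$, $\tilde\delta=\frac1M\mathrm{tr}(\widetilde{\mathbf D}\widetilde{\mathbf\Gamma})$, where $$\mathbf\Phi=(\mathbf I+\tilde\delta\mathbf D)^{-1},\quad \widetilde{\mathbf\Phi}=(\mathbf I+\delta\widetilde{\mathbf D})^{-1},\quad \mathbf\Gamma=[\sigma^2\mathbf\Phi^{-1}+\mathbf B\widetilde{\mathbf\Phi}\mathbf B^{\mathrm H}]^{-1},\quad \widetilde{\mathbf\Gamma}=[\sigma^2\widetilde{\mathbf\Phi}^{-1}+\mathbf B^{\mathrm H}\mathbf\Phi\mathbf B]^{-1},$$ has a unique solution with $\delta,\tilde\delta>0$. Regard $\delta,\tilde\delta$, the matrices $\mathbf\Phi,\widetilde{\mathbf\Phi},\mathbf\Gamma,\widetilde{\mathbf\Gamma}$ at this solution, $\mathbf\Xi=\mathbf B\widetilde{\mathbf\Phi}\mathbf B^{\mathrm H}$ and $\widetilde{\mathbf\Xi}=\mathbf B^{\mathrm H}\mathbf\Phi\mathbf B$ as functions of $\mathbf T$, and let $$\overline{\mathcal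 R}_e(\mathbf T)=-\log|\sigma^2\mathbf\Gamma|+\log|\mathbf I+\delta\widetilde{\mathbf D}|-\sigma^2M\delta\tilde\delta$$ be the deterministic equivalent of the ergodic eavesdropper rate. Then for every $\mathbf T$, every $n$ and every $i\in\{1,2\}$, all these functions have partial derivatives with respect to the $i$-th entry $t_{n,i}$ of $\mathbf t_n$, denoted by $(\cdot)'_{(n,i)}$. The derivative of the $n$-th column $\tilde{\mathbf g}(\mathbf t_n)$ of $\mathbf G_{\mathrm{LoS}}^{\mathrm H}$ is the vector $\tilde{\mathbf g}'_{n,i}$ with entries $-j\frac{2\pi}{\lambda}[\boldsymbol\rho_m]_ie^{-j\frac{2\pi}{\lambda}\mathbf t_n^{\mathrm T}\boldsymbol\rho_m}$, $m=1,\dots,M$. The derivatives satisfy the linear fixed-point system $$\delta'_{(n,i)}=\tfrac1M\mathrm{tr}(\mathbf D\mathbf\Gamma'_{(n,i)}),\qquad \tilde\delta'_{(n,i)}=\tfrac1M\mathrm{tr}(\widetilde{\mathbf D}\widetilde{\mathbf\Gamma}'_{(n,i)}),$$ where $$\mathbf\Gamma'_{(n,i)}=-\mathbf\Gamma\big(\sigma^2\tilde\delta'_{(n,i)}\mathbf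 D+\mathbf\Xi'_{(n,i)}\big)\mathbf\Gamma,\qquad \widetilde{\mathbf\Gamma}'_{(n,i)}=-\widetilde{\mathbf\Gamma}\big(\sigma^2\delta'_{(n,i)}\widetilde{\mathbf D}+\widetilde{\mathbf\Xi}'_{(n,i)}\big)\widetilde{\mathbf\Gamma},$$ $$\mathbf\Phi'_{(n,i)}=-\mathbf\Phi(\tilde\delta'_{(n,i)}\mathbf D)\mathbf\Phi,\qquad \widetilde{\mathbf\Phi}'_{(n,i)}=-\widetilde{\mathbf\Phi}(\delta'_{(n,i)}\widetilde{\mathbf D})\widetilde{\mathbf\Phi},$$ $$\mathbf\Xi'_{(n,i)}=\mathbf B\widetilde{\mathbf\Phi}'_{(n,i)}\mathbf B^{\mathrm H}+2\Re\big(\mathbf\Lambda^{1/2}\tilde{\mathbf g}'_{n,i}\mathbf e_n^{\mathrm T}\mathbf F\widetilde{\mathbf\Phi}\mathbf B^{\mathrm H}\big),\qquad \widetilde{\mathbf\Xi}'_{(n,i)}=\mathbf B^{\mathrm H}\mathbf\Phi'_{(n,i)}\mathbf B+2\Re\big(\mathbf B^{\mathrm H}\mathbf\Phi\mathbf\Lambda^{1/2}\tilde{\mathbf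 g}'_{n,i}\mathbf e_n^{\mathrm T}\mathbf F\big),$$ with $2\Re(\mathbf X)=\mathbf X+\mathbf X^{\mathrm H}$ (twice the Hermitian part) and $\mathbf e_n$ the $n$-th standard basis vector. Moreover $\overline{\mathcal R}_e$ is differentiable in $\mathbf t_n$, and the $i$-th entry of its gradient with respect to $\mathbf t_n$ is $$[\nabla_{e,\mathbf t_n}]_i=-\mathrm{tr}\big(\mathbf\Gamma^{-1}\mathbf\Gamma'_{(n,i)}\big)+\delta'_{(n,i)}\,\mathrm{tr}\big(\widetilde{\mathbf\Phi}\widetilde{\mathbf D}\big)-\sigma^2M\big(\delta'_{(n,i)}\tilde\delta+\delta\tilde\delta'_{(n,i)}\big).$$ -/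

import Mathlib

/-
Both right-hand sides of the fixed-point system have the form `f z = c Re tr (P K(z)⁻¹)` with
`K(z) = s (I + z₂ P) + A (I + z₁ Q)⁻¹ Aᴴ`, where `z = (δ, δ̃)` up to a swap. Such an `f` satisfies
`z₁ |∂₁ f| + z₂ |∂₂ f| < f`, so in logarithmic coordinates and for the sup norm the system asks for
a fixed point of a map that strictly decreases distances. This gives uniqueness, and, since the
right-hand sides are bounded and the map therefore preserves a compact box, existence by
Edelstein's theorem. The same inequality shows that `1` is not an eigenvalue of the derivative of
the map at the fixed point, so by the implicit function theorem `δ` and `δ̃` depend smoothly on the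
positions. The formulas are then the rules for differentiating products, inverses and `log det`.
-/

open scoped Matrix

noncomputable section

namespace MIMOME

/-- Configuration of the positions of the `N` movable antennas: `T n` is the position in the
plane of antenna `n`. -/
abbrev Positions (N : ℕ) : Type := Fin N → EuclideanSpace ℝ (Fin 2)

/-- The fixed data of the eavesdropping system: `N` transmit antennas, `M` cooperating
single-antenna eavesdroppers and `M` data streams. -/
structure System (N M : ℕ) where
  /-- wavelength -/
  lam : ℝ
  /-- standard deviation of the noise (the noise power is `σ ^ 2`) -/
  σ : ℝ
  /-- path losses -/
  β : Fin M → ℝ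
  /-- Rician factors -/
  K : Fin M → ℝ
  /-- elevation angles of the line-of-sight paths -/
  θ : Fin M → ℝ
  /-- azimuth angles of the line-of-sight paths -/
  φ : Fin M → ℝ
  /-- precoding matrix -/
  F : Matrix (Fin N) (Fin M) ℂ

namespace System

variable {N M : ℕ} (S : System N M)

/-- The direction vector `ρ_m = (sin θ_m cos φ_m, cos θ_m)` of the `m`-th eavesdropper. -/
def rho (m : Fin M) : Fin 2 → ℝ :=
  ![Real.sin (S.θ m) * Real.cos (S.φ m), Real.cos (S.θ m)]

/-- The line-of-sight channel; its `m`-th column is the field-response vector with entries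
`exp (j (2π/λ) t_nᵀ ρ_m)`. -/
def GLoS (T : Positions N) : Matrix (Fin N) (Fin M) ℂ :=
  Matrix.of fun n m =>
    Complex.exp (Complex.I * ((2 * Real.pi / S.lam * ∑ i, T n i * S.rho m i : ℝ) : ℂ))

/-- The square root of `Λ = diag (K_m β_m / (K_m + 1))`. -/
def sqrtLambda : Matrix (Fin M) (Fin M) ℂ :=
  Matrix.diagonal fun m => ((Real.sqrt (S.K m * S.β m / (S.K m + 1)) : ℝ) : ℂ)

/-- `B = Λ^{1/2} G_LoSᴴ F`. -/
def B (T : Positions N) : Matrix (Fin M) (Fin M) ℂ :=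
  S.sqrtLambda * (S.GLoS T)ᴴ * S.F

/-- `D = diag (M β_m / (K_m + 1))`. -/
def D : Matrix (Fin M) (Fin M) ℂ :=
  Matrix.diagonal fun m => (((M : ℝ) * S.β m / (S.K m + 1) : ℝ) : ℂ)

/-- `D̃ = diag (‖f_k‖²)`, where `f_k` is the `k`-th column of `F`. -/
def Dt : Matrix (Fin M) (Fin M) ℂ :=
  Matrix.diagonal fun k => ((∑ n, ‖S.F n k‖ ^ 2 : ℝ) : ℂ)

/-- `Φ = (I + δ̃ D)⁻¹`, as a function of the scalar `δ̃ = y`. -/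
def PhiOf (y : ℝ) : Matrix (Fin M) (Fin M) ℂ := (1 + (y : ℂ) • S.D)⁻¹

/-- `Φ̃ = (I + δ D̃)⁻¹`, as a function of the scalar `δ = x`. -/
def PhitOf (x : ℝ) : Matrix (Fin M) (Fin M) ℂ := (1 + (x : ℂ) • S.Dt)⁻¹

/-- `Γ = [σ² Φ⁻¹ + B Φ̃ Bᴴ]⁻¹`, as a function of the positions and of `δ = x`, `δ̃ = y`. -/
def GamOf (T : Positions N) (x y : ℝ) : Matrix (Fin M) (Fin M) ℂ :=
  ((S.σ : ℂ) ^ 2 • (S.PhiOf y)⁻¹ + S.B T * S.PhitOf x * (S.B T)ᴴ)⁻¹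

/-- `Γ̃ = [σ² Φ̃⁻¹ + Bᴴ Φ B]⁻¹`, as a function of the positions and of `δ = x`, `δ̃ = y`. -/
def GamtOf (T : Positions N) (x y : ℝ) : Matrix (Fin M) (Fin M) ℂ :=
  ((S.σ : ℂ) ^ 2 • (S.PhitOf x)⁻¹ + (S.B T)ᴴ * S.PhiOf y * S.B T)⁻¹

/-- `p = (δ, δ̃)` is a positive solution, at the positions `T`, of
`δ = (1/M) tr (D Γ)`, `δ̃ = (1/M) tr (D̃ Γ̃)`. -/
def IsPositiveSolution (T : Positions N) (p : ℝ × ℝ) : Prop :=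
  0 < p.1 ∧ 0 < p.2 ∧
    (p.1 : ℂ) = 1 / (M : ℂ) * (S.D * S.GamOf T p.1 p.2).trace ∧
    (p.2 : ℂ) = 1 / (M : ℂ) * (S.Dt * S.GamtOf T p.1 p.2).trace

/-- The positive solution of the fixed-point system at the positions `T`. -/
def fixedPoint (T : Positions N) : ℝ × ℝ :=
  Classical.epsilon fun p => S.IsPositiveSolution T p

/-- `δ`, as a function of the positions. -/
def delta (T : Positions N) : ℝ := (S.fixedPoint T).1

/-- `δ̃`, as a function of the positions. -/
def deltat (T : Positions N) : ℝ := (S.fixedPoint T).2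

/-- `Φ`, as a function of the positions. -/
def Phi (T : Positions N) : Matrix (Fin M) (Fin M) ℂ := S.PhiOf (S.deltat T)

/-- `Φ̃`, as a function of the positions. -/
def Phit (T : Positions N) : Matrix (Fin M) (Fin M) ℂ := S.PhitOf (S.delta T)

/-- `Γ`, as a function of the positions. -/
def Gam (T : Positions N) : Matrix (Fin M) (Fin M) ℂ :=
  S.GamOf T (S.delta T) (S.deltat T)

/-- `Γ̃`, as a function of the positions. -/
def Gamt (T : Positions N) : Matrix (Fin M) (Fin M) ℂ :=
  S.GamtOf T (S.delta T) (S.deltat T)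

/-- `Ξ = B Φ̃ Bᴴ`, as a function of the positions. -/
def Xi (T : Positions N) : Matrix (Fin M) (Fin M) ℂ := S.B T * S.Phit T * (S.B T)ᴴ

/-- `Ξ̃ = Bᴴ Φ B`, as a function of the positions. -/
def Xit (T : Positions N) : Matrix (Fin M) (Fin M) ℂ := (S.B T)ᴴ * S.Phi T * S.B T

/-- The deterministic equivalent of the ergodic eavesdropper rate,
`-log |σ² Γ| + log |I + δ D̃| - σ² M δ δ̃`. Both matrices are Hermitian positive definite, so
their determinants are positive reals, and taking the real part only changes the type. -/
def rate (T : Positions N) : ℝ :=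
  -Real.log ((S.σ : ℂ) ^ 2 • S.Gam T).det.re
    + Real.log (1 + (S.delta T : ℂ) • S.Dt).det.re
    - S.σ ^ 2 * M * S.delta T * S.deltat T

/-- The vector `g̃'_{n,i}` with entries `-j (2π/λ) [ρ_m]_i exp (-j (2π/λ) t_nᵀ ρ_m)`. -/
def gtDeriv (T : Positions N) (n : Fin N) (i : Fin 2) : Fin M → ℂ := fun m =>
  -Complex.I * ((2 * Real.pi / S.lam * S.rho m i : ℝ) : ℂ) *
    Complex.exp (-Complex.I * ((2 * Real.pi / S.lam * ∑ k, T n k * S.rho m k : ℝ) : ℂ))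

end System

/-- The unit direction in the space of positions that moves the `i`-th coordinate of antenna `n`
and nothing else. -/
def coordDir {N : ℕ} (n : Fin N) (i : Fin 2) : Positions N :=
  Pi.single n (EuclideanSpace.single i (1 : ℝ))

/-- The matrix-valued function `A` of the positions has at `T`, entry by entry, the partial
derivative `A'` with respect to `t_{n,i}`. -/
def HasMatrixPartial {N M : ℕ} (A : Positions N → Matrix (Fin M) (Fin M) ℂ)
    (A' : Matrix (Fin M) (Fin M) ℂ) (T : Positions N) (n : Fin N) (i : Fin 2) : Prop :=
  ∀ a b, HasLineDerivAt ℝ (fun T' => A T' a b) (A' a b) T (coordDir n i)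

/-- Twice the Hermitian part of a square matrix, `2 Re X = X + Xᴴ`. -/
def twoRe {M : ℕ} (X : Matrix (Fin M) (Fin M) ℂ) : Matrix (Fin M) (Fin M) ℂ := X + Xᴴ

end MIMOME

end

noncomputable section

open scoped Matrix ComplexOrder Topology ContDiff

namespace MIMOME

section Trace

open scoped MatrixOrder Matrix.Norms.L2Operator

variable {𝕜 ι : Type*} [RCLike 𝕜] [Fintype ι] {P X : Matrix ι ι 𝕜}

lemma trace_mul_conjTranspose_mul_self (P Y : Matrix ι ι 𝕜) :
    (P * (Yᴴ * Y)).trace = (Y * P * Yᴴ).trace := by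
  rw [← mul_assoc, Matrix.trace_mul_comm, ← mul_assoc]

lemma re_trace_mul_nonneg (hP : P.PosSemidef) (hX : X.PosSemidef) :
    0 ≤ RCLike.re (P * X).trace := by
  classical
  obtain ⟨Y, rfl⟩ := CStarAlgebra.nonneg_iff_eq_star_mul_self.mp hX.nonneg
  rw [Matrix.star_eq_conjTranspose, trace_mul_conjTranspose_mul_self]
  exact (RCLike.nonneg_iff.1 (hP.mul_mul_conjTranspose_same Y).trace_nonneg).1

lemma re_trace_mul_pos (hP : P.PosSemidef) (hP0 : P ≠ 0) (hX : X.PosDef) :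
    0 < RCLike.re (P * X).trace := by
  classical
  obtain ⟨Y, hY, rfl⟩ := CStarAlgebra.isStrictlyPositive_iff_eq_star_mul_self.mp
    hX.isStrictlyPositive
  have hcong : Y * P * Yᴴ ≠ 0 := by
    rwa [Ne, ← Matrix.star_eq_conjTranspose, IsUnit.mul_left_eq_zero hY.star, hY.mul_right_eq_zero]
  have hpsd := hP.mul_mul_conjTranspose_same Y
  rw [Matrix.star_eq_conjTranspose, trace_mul_conjTranspose_mul_self]
  exact (RCLike.pos_iff.1 (hpsd.trace_nonneg.lt_of_ne' (mt hpsd.trace_eq_zero_iff.1 hcong))).1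

end Trace

lemma ofReal_re_trace_mul {𝕜 ι : Type*} [RCLike 𝕜] [Fintype ι] {X Y : Matrix ι ι 𝕜}
    (hX : X.IsHermitian) (hY : Y.IsHermitian) :
    ((RCLike.re (X * Y).trace : ℝ) : 𝕜) = (X * Y).trace := by
  rw [← RCLike.conj_eq_iff_re, starRingEnd_apply, ← Matrix.trace_conjTranspose,
    Matrix.conjTranspose_mul, hX.eq, hY.eq, Matrix.trace_mul_comm]

lemma re_trace_mul_inv_le {𝕜 ι : Type*} [RCLike 𝕜] [Fintype ι] [DecidableEq ι]
    {P K : Matrix ι ι 𝕜} {s : ℝ} (hs : 0 < s) (hP : P.PosSemidef) (hK : K.PosDef)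
    (hKs : (K - s • 1).PosSemidef) :
    RCLike.re (P * K⁻¹).trace ≤ s⁻¹ * RCLike.re P.trace := by
  have hH : (K⁻¹)ᴴ = K⁻¹ := hK.inv.isHermitian.eq
  have hKK : K⁻¹ * K = 1 := Matrix.nonsing_inv_mul _ ((Matrix.isUnit_iff_isUnit_det _).1 hK.isUnit)
  have hsq : s * RCLike.re (P * (K⁻¹ * K⁻¹)).trace ≤ RCLike.re (P * K⁻¹).trace := by
    have h := re_trace_mul_nonneg hP (hKs.mul_mul_conjTranspose_same K⁻¹)
    simpa [hH, hKK, mul_sub, sub_mul, RCLike.smul_re] using h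
  have hone : 0 ≤ RCLike.re P.trace - 2 * s * RCLike.re (P * K⁻¹).trace
      + s ^ 2 * RCLike.re (P * (K⁻¹ * K⁻¹)).trace := by
    have h := re_trace_mul_nonneg hP (Matrix.posSemidef_self_mul_conjTranspose (1 - s • K⁻¹))
    simp only [Matrix.conjTranspose_sub, Matrix.conjTranspose_smul, hH, Matrix.conjTranspose_one,
      star_trivial, mul_sub, sub_mul, one_mul, mul_one, mul_smul_comm, smul_mul_assoc, smul_sub,
      smul_smul, Matrix.trace_sub, Matrix.trace_smul, map_sub, RCLike.smul_re] at h
    linarith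
  rw [inv_mul_eq_div, le_div_iff₀ hs]
  nlinarith

section MatrixCalculus

attribute [local instance] Matrix.linftyOpNormedAddCommGroup Matrix.linftyOpNormedSpace

variable {𝕜 ι κ μ E : Type*} [RCLike 𝕜] [NormedAddCommGroup E] [NormedSpace ℝ E] {t : ℝ} {e : E}
  {n : WithTop ℕ∞}

/-- Matrices and families of entries agree as real normed spaces up to equivalence; this transfers
the calculus of `Pi` types to matrices. -/
def matrixEntriesCLE [Finite ι] [Finite κ] : Matrix ι κ 𝕜 ≃L[ℝ] (ι → κ → 𝕜) :=
  (Matrix.ofLinearEquiv ℝ).symm.toContinuousLinearEquiv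

lemma hasDerivAt_matrix_iff [Finite ι] [Finite κ] {X : ℝ → Matrix ι κ 𝕜} {X' : Matrix ι κ 𝕜} :
    HasDerivAt X X' t ↔ ∀ i k, HasDerivAt (fun u => X u i k) (X' i k) t := by
  have := Fintype.ofFinite ι
  have := Fintype.ofFinite κ
  have key : HasDerivAt X X' t ↔
      HasDerivAt (matrixEntriesCLE ∘ X) (matrixEntriesCLE X') t := by
    refine ⟨fun h => matrixEntriesCLE.hasFDerivAt.comp_hasDerivAt t h, fun h => ?_⟩
    exact matrixEntriesCLE.symm.hasFDerivAt.comp_hasDerivAt t h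
  rw [key, hasDerivAt_pi]
  exact forall_congr' fun i => hasDerivAt_pi

lemma contDiffAt_matrix_iff [Fintype ι] [Fintype κ] {X : E → Matrix ι κ 𝕜} :
    ContDiffAt ℝ n X e ↔ ∀ i k, ContDiffAt ℝ n (fun u => X u i k) e := by
  rw [← matrixEntriesCLE.comp_contDiffAt_iff, contDiffAt_pi]
  exact forall_congr' fun i => contDiffAt_pi

lemma hasDerivAt_matrix_mul [Finite ι] [Fintype κ] [Finite μ] {X : ℝ → Matrix ι κ 𝕜}
    {Y : ℝ → Matrix κ μ 𝕜} {X' : Matrix ι κ 𝕜} {Y' : Matrix κ μ 𝕜} (hX : HasDerivAt X X' t)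
    (hY : HasDerivAt Y Y' t) :
    HasDerivAt (fun u => X u * Y u) (X' * Y t + X t * Y') t :=
  hasDerivAt_matrix_iff.2 fun i j => by
    simpa only [Matrix.mul_apply, Matrix.add_apply, ← Finset.sum_add_distrib] using
      HasDerivAt.fun_sum fun k _ =>
        (hasDerivAt_matrix_iff.1 hX i k).fun_mul (hasDerivAt_matrix_iff.1 hY k j)

lemma contDiffAt_matrix_mul [Fintype ι] [Fintype κ] [Fintype μ] {X : E → Matrix ι κ 𝕜}
    {Y : E → Matrix κ μ 𝕜} (hX : ContDiffAt ℝ n X e) (hY : ContDiffAt ℝ n Y e) :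
    ContDiffAt ℝ n (fun u => X u * Y u) e :=
  contDiffAt_matrix_iff.2 fun i j => by
    simpa only [Matrix.mul_apply] using ContDiffAt.sum fun k _ =>
      (contDiffAt_matrix_iff.1 hX i k).mul (contDiffAt_matrix_iff.1 hY k j)

lemma hasDerivAt_conjTranspose [Finite ι] [Finite κ] {X : ℝ → Matrix ι κ 𝕜}
    {X' : Matrix ι κ 𝕜} (h : HasDerivAt X X' t) : HasDerivAt (fun u => (X u)ᴴ) X'ᴴ t :=
  hasDerivAt_matrix_iff.2 fun i j => (hasDerivAt_matrix_iff.1 h j i).star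

lemma contDiffAt_conjTranspose [Fintype ι] [Fintype κ] {X : E → Matrix ι κ 𝕜}
    (h : ContDiffAt ℝ n X e) :
    ContDiffAt ℝ n (fun u => (X u)ᴴ) e :=
  contDiffAt_matrix_iff.2 fun i j =>
    (RCLike.conjCLE (K := 𝕜)).contDiff.contDiffAt.comp e (contDiffAt_matrix_iff.1 h j i)

lemma isHermitian_of_hasDerivAt [Finite ι] {X : ℝ → Matrix ι ι 𝕜} {X' : Matrix ι ι 𝕜}
    (h : HasDerivAt X X' t) (hX : ∀ u, (X u).IsHermitian) : X'.IsHermitian := by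
  have := Fintype.ofFinite ι
  have hstar := hasDerivAt_conjTranspose h
  simp only [fun u => (hX u).eq] at hstar
  exact hstar.unique h

lemma hasDerivAt_trace [Fintype ι] {X : ℝ → Matrix ι ι 𝕜} {X' : Matrix ι ι 𝕜}
    (h : HasDerivAt X X' t) :
    HasDerivAt (fun u => (X u).trace) X'.trace t :=
  HasDerivAt.fun_sum fun i _ => hasDerivAt_matrix_iff.1 h i i

lemma contDiffAt_trace [Fintype ι] {X : E → Matrix ι ι 𝕜} (h : ContDiffAt ℝ n X e) :
    ContDiffAt ℝ n (fun u => (X u).trace) e :=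
  ContDiffAt.sum fun i _ => contDiffAt_matrix_iff.1 h i i

lemma hasDerivAt_mul_mul_conjTranspose [Finite ι] [Fintype κ] {A : ℝ → Matrix ι κ 𝕜}
    {A' : Matrix ι κ 𝕜} {V : ℝ → Matrix κ κ 𝕜} {V' : Matrix κ κ 𝕜} (hA : HasDerivAt A A' t)
    (hV : HasDerivAt V V' t) (hHerm : (V t).IsHermitian) :
    HasDerivAt (fun u => A u * V u * (A u)ᴴ)
      (A t * V' * (A t)ᴴ + (A' * V t * (A t)ᴴ + (A' * V t * (A t)ᴴ)ᴴ)) t := by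
  have := Fintype.ofFinite ι
  refine (hasDerivAt_matrix_mul (hasDerivAt_matrix_mul hA hV)
    (hasDerivAt_conjTranspose hA)).congr_deriv ?_
  simp only [Matrix.conjTranspose_mul, Matrix.conjTranspose_conjTranspose, hHerm.eq, Matrix.add_mul,
    Matrix.mul_assoc]
  abel

variable [Fintype ι] [DecidableEq ι]

section Inverse

attribute [local instance] Matrix.linftyOpNormedRing Matrix.linftyOpNormedAlgebra

lemma hasDerivAt_matrix_inv {X : ℝ → Matrix ι ι 𝕜} {X' : Matrix ι ι 𝕜} (h : HasDerivAt X X' t)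
    (hX : IsUnit (X t)) : HasDerivAt (fun u => (X u)⁻¹) (-((X t)⁻¹ * X' * (X t)⁻¹)) t := by
  obtain ⟨U, hU⟩ := hX
  have hinv := hU ▸ hasFDerivAt_ringInverse (𝕜 := ℝ) U
  simp only [Matrix.nonsing_inv_eq_ringInverse]
  refine (hinv.comp_hasDerivAt t h).congr_deriv ?_
  simp [← hU]

lemma contDiffAt_matrix_inv {X : E → Matrix ι ι 𝕜} (h : ContDiffAt ℝ n X e)
    (hX : IsUnit (X e)) : ContDiffAt ℝ n (fun u => (X u)⁻¹) e := by
  obtain ⟨U, hU⟩ := hX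
  have hinv : ContDiffAt ℝ n Ring.inverse (X e) := hU ▸ contDiffAt_ringInverse ℝ U
  simp only [Matrix.nonsing_inv_eq_ringInverse]
  exact hinv.comp e h

end Inverse

lemma contDiffAt_det {X : E → Matrix ι ι 𝕜} (h : ContDiffAt ℝ n X e) :
    ContDiffAt ℝ n (fun u => (X u).det) e := by
  simp only [Matrix.det_apply']
  exact ContDiffAt.sum fun τ _ => contDiffAt_const.mul
    (contDiffAt_prod fun i _ => contDiffAt_matrix_iff.1 h _ _)

lemma hasDerivAt_det_one_add_smul (X : Matrix ι ι 𝕜) :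
    HasDerivAt (fun u : ℝ => (1 + u • X).det) X.trace 0 := by
  have hfield : HasDerivAt (fun r : 𝕜 => (1 + r • X).det) X.trace 0 := by
    rw [funext fun r : 𝕜 => Matrix.det_one_add_smul r X]
    refine ((((hasDerivAt_id (0 : 𝕜)).const_mul X.trace).const_add 1).add
      ((Polynomial.hasDerivAt _ (0 : 𝕜)).mul ((hasDerivAt_id 0).pow 2))).congr_deriv ?_
    simp
  have hreal := hfield.scomp_of_eq (0 : ℝ) (RCLike.ofRealCLM (K := 𝕜)).hasDerivAt (by simp)
  simpa [Function.comp_def, ← RCLike.real_smul_eq_coe_smul] using hreal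

lemma hasDerivAt_det {X : ℝ → Matrix ι ι 𝕜} {X' : Matrix ι ι 𝕜} (h : HasDerivAt X X' t)
    (hX : IsUnit (X t)) :
    HasDerivAt (fun u => (X u).det) ((X t).det * ((X t)⁻¹ * X').trace) t := by
  have hunit := (Matrix.isUnit_iff_isUnit_det _).1 hX
  have hdet : HasFDerivAt Matrix.det (fderiv ℝ Matrix.det (1 : Matrix ι ι 𝕜)) 1 :=
    ((contDiffAt_det contDiffAt_id).differentiableAt one_ne_zero).hasFDerivAt
  have htrace (Y : Matrix ι ι 𝕜) : fderiv ℝ Matrix.det (1 : Matrix ι ι 𝕜) Y = Y.trace :=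
    HasDerivAt.unique (hdet.hasLineDerivAt Y) (hasDerivAt_det_one_add_smul Y)
  have hmul : HasDerivAt (fun u => (X t)⁻¹ * X u) ((X t)⁻¹ * X') t := by
    simpa using hasDerivAt_matrix_mul (hasDerivAt_const t (X t)⁻¹) h
  have hone := (hdet.comp_hasDerivAt_of_eq t hmul
    (Matrix.nonsing_inv_mul _ hunit).symm).congr_deriv (htrace _)
  simpa [Function.comp_def, Matrix.det_mul, ← mul_assoc, Matrix.det_nonsing_inv,
    hunit.ne_zero] using hone.const_mul (X t).det

lemma hasDerivAt_log_det_re {X : ℝ → Matrix ι ι 𝕜} {X' : Matrix ι ι 𝕜} (h : HasDerivAt X X' t)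
    (hX : (X t).PosDef) :
    HasDerivAt (fun u => Real.log (RCLike.re (X u).det))
      (RCLike.re ((X t)⁻¹ * X').trace) t := by
  obtain ⟨hre, him⟩ := RCLike.pos_iff.1 hX.det_pos
  have hdet := (RCLike.reCLM (K := 𝕜)).hasFDerivAt.comp_hasDerivAt t (hasDerivAt_det h hX.isUnit)
  refine (hdet.log hre.ne').congr_deriv ?_
  simp [RCLike.mul_re, him, hre.ne']

lemma contDiffAt_log_det_re {X : E → Matrix ι ι 𝕜} (h : ContDiffAt ℝ n X e)
    (hX : (X e).PosDef) : ContDiffAt ℝ n (fun u => Real.log (RCLike.re (X u).det)) e :=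
  ((RCLike.reCLM (K := 𝕜)).contDiff.contDiffAt.comp e (contDiffAt_det h)).log
    (RCLike.pos_iff.1 hX.det_pos).1.ne'

lemma hasDerivAt_inv_one_add_smul {x : ℝ → ℝ} {x' : ℝ} {Q : Matrix ι ι 𝕜}
    (hx : HasDerivAt x x' t) (hunit : IsUnit (1 + x t • Q)) :
    HasDerivAt (fun u => (1 + x u • Q)⁻¹) (-((1 + x t • Q)⁻¹ * (x' • Q) * (1 + x t • Q)⁻¹)) t :=
  hasDerivAt_matrix_inv ((hx.smul_const Q).const_add 1) hunit

end MatrixCalculus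

section LogContracting

theorem exists_fixedPt_of_dist_lt {X : Type*} [MetricSpace X] {s : Set X} {F : X → X}
    (hs : IsCompact s) (hne : s.Nonempty) (hF : Set.MapsTo F s s)
    (hdist : ∀ x ∈ s, ∀ y ∈ s, x ≠ y → dist (F x) (F y) < dist x y) :
    ∃ x ∈ s, Function.IsFixedPt F x := by
  have hcont : ContinuousOn F s := (LipschitzOnWith.of_dist_le_mul (K := 1) fun x hx y hy => by
    rcases eq_or_ne x y with rfl | hxy
    · simp
    · simpa using (hdist x hx y hy hxy).le).continuousOn
  obtain ⟨x, hx, hmin⟩ := hs.exists_isMinOn hne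
    (f := fun x => dist (F x) x) (continuous_dist.comp_continuousOn (hcont.prodMk continuousOn_id))
  refine ⟨x, hx, by_contra fun hfix => ?_⟩
  exact (hdist _ (hF hx) x hx hfix).not_ge (hmin (hF hx))

/-- The function `f` is, at every point of the closed quadrant, strictly contracting when its
arguments and values are measured in logarithmic coordinates, with the sup norm on arguments:
`z * w` is the velocity at `z` of a motion whose logarithmic velocity is `w`. -/
def LogContracting (f : ℝ × ℝ → ℝ) : Prop :=
  ∀ z, 0 ≤ z → DifferentiableAt ℝ f z ∧ ∀ w, w ≠ 0 → |fderiv ℝ f z (z * w)| < f z * ‖w‖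

/-- The parametrization of the open quadrant by logarithmic coordinates. -/
def expPair (u : ℝ × ℝ) : ℝ × ℝ := (Real.exp u.1, Real.exp u.2)

/-- Logarithmic coordinates on the open quadrant; junk outside of it. -/
def logPair (z : ℝ × ℝ) : ℝ × ℝ := (Real.log z.1, Real.log z.2)

lemma expPair_nonneg (u : ℝ × ℝ) : 0 ≤ expPair u :=
  ⟨(Real.exp_pos _).le, (Real.exp_pos _).le⟩

lemma expPair_logPair {z : ℝ × ℝ} (h₁ : 0 < z.1) (h₂ : 0 < z.2) : expPair (logPair z) = z :=
  Prod.ext (Real.exp_log h₁) (Real.exp_log h₂)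

lemma hasDerivAt_expPair {u : ℝ → ℝ × ℝ} {u' : ℝ × ℝ} {t : ℝ} (hu : HasDerivAt u u' t) :
    HasDerivAt (fun r => expPair (u r)) (expPair (u t) * u') t :=
  (HasDerivAt.exp hu.fst).prodMk (HasDerivAt.exp hu.snd)

namespace LogContracting

variable {f g : ℝ × ℝ → ℝ} {z : ℝ × ℝ}

lemma pos (hf : LogContracting f) (hz : 0 ≤ z) : 0 < f z := by
  simpa using (abs_nonneg _).trans_lt ((hf z hz).2 1 one_ne_zero)

lemma continuousOn (hf : LogContracting f) : ContinuousOn f (Set.Ici 0) := fun z hz =>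
  (hf z hz).1.continuousAt.continuousWithinAt

lemma comp_swap (hf : LogContracting f) : LogContracting fun z => f z.swap := by
  intro z hz
  obtain ⟨hdiff, hlt⟩ := hf z.swap hz.symm
  have hcomp := hdiff.hasFDerivAt.comp z (ContinuousLinearEquiv.prodComm ℝ ℝ ℝ).hasFDerivAt
  refine ⟨hcomp.differentiableAt, fun w hw => ?_⟩
  have hnorm : ‖w.swap‖ = ‖w‖ := max_comm _ _
  have hw' : w.swap ≠ 0 := by rwa [← norm_ne_zero_iff, hnorm, norm_ne_zero_iff]
  exact hcomp.fderiv ▸ hnorm ▸ hlt w.swap hw'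

lemma dist_log_lt (hf : LogContracting f) {u v : ℝ × ℝ} (huv : u ≠ v) :
    dist (Real.log (f (expPair u))) (Real.log (f (expPair v))) < dist u v := by
  let γ : ℝ → ℝ × ℝ := AffineMap.lineMap v u
  have hderiv (t : ℝ) : HasDerivAt (fun r => Real.log (f (expPair (γ r))))
      (fderiv ℝ f (expPair (γ t)) (expPair (γ t) * (u - v)) / f (expPair (γ t))) t :=
    ((hf _ (expPair_nonneg _)).1.hasFDerivAt.comp_hasDerivAt t
      (hasDerivAt_expPair AffineMap.hasDerivAt_lineMap)).log (hf.pos (expPair_nonneg _)).ne'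
  obtain ⟨t, -, ht⟩ := exists_hasDerivAt_eq_slope _ _ zero_lt_one
    (fun t _ => (hderiv t).continuousAt.continuousWithinAt) (fun t _ => hderiv t)
  have hpos := hf.pos (expPair_nonneg (γ t))
  have hlt := (hf _ (expPair_nonneg (γ t))).2 _ (sub_ne_zero.2 huv)
  simp only [γ, AffineMap.lineMap_apply_one, AffineMap.lineMap_apply_zero, sub_zero, div_one] at ht
  rwa [dist_eq_norm u, Real.dist_eq, ← ht, abs_div, abs_of_pos hpos, div_lt_iff₀ hpos, mul_comm ‖_‖]

lemma dist_logPair_lt (hf : LogContracting f) (hg : LogContracting g) {u v : ℝ × ℝ}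
    (huv : u ≠ v) :
    dist (logPair (f (expPair u), g (expPair u))) (logPair (f (expPair v), g (expPair v)))
      < dist u v :=
  max_lt (hf.dist_log_lt huv) (hg.dist_log_lt huv)

lemma eq_of_fixed (hf : LogContracting f) (hg : LogContracting g) {z w : ℝ × ℝ}
    (hz₁ : 0 < z.1) (hz₂ : 0 < z.2) (hz : (f z, g z) = z)
    (hw₁ : 0 < w.1) (hw₂ : 0 < w.2) (hw : (f w, g w) = w) : z = w := by
  by_contra hne
  have hlog : logPair z ≠ logPair w := fun h => hne <| by
    rw [← expPair_logPair hz₁ hz₂, h, expPair_logPair hw₁ hw₂]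
  have hlt := hf.dist_logPair_lt hg hlog
  rw [expPair_logPair hz₁ hz₂, expPair_logPair hw₁ hw₂, hz, hw] at hlt
  exact hlt.false

lemma exists_pos_le (hf : LogContracting f) (b : ℝ × ℝ) :
    ∃ m, 0 < m ∧ ∀ z, 0 ≤ z → z ≤ b → m ≤ f z := by
  rcases (Set.Icc 0 b).eq_empty_or_nonempty with hempty | hne
  · exact ⟨1, one_pos, fun z hz hzb => (hempty.subset ⟨hz, hzb⟩).elim⟩
  · obtain ⟨z₀, hz₀, hmin⟩ := isCompact_Icc.exists_isMinOn hne
      (hf.continuousOn.mono Set.Icc_subset_Ici_self)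
    exact ⟨f z₀, hf.pos hz₀.1, fun z hz hzb => hmin ⟨hz, hzb⟩⟩

lemma exists_fixed (hf : LogContracting f) (hg : LogContracting g)
    (hfb : BddAbove (f '' Set.Ici 0)) (hgb : BddAbove (g '' Set.Ici 0)) :
    ∃ z : ℝ × ℝ, 0 < z.1 ∧ 0 < z.2 ∧ (f z, g z) = z := by
  obtain ⟨a, ha⟩ := hfb
  obtain ⟨b, hb⟩ := hgb
  replace ha z (hz : 0 ≤ z) : f z ≤ a := ha ⟨z, hz, rfl⟩
  replace hb z (hz : 0 ≤ z) : g z ≤ b := hb ⟨z, hz, rfl⟩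
  obtain ⟨m, hm, hfm⟩ := hf.exists_pos_le (a, b)
  obtain ⟨l, hl, hgl⟩ := hg.exists_pos_le (a, b)
  have ha0 : 0 < a := (hf.pos le_rfl).trans_le (ha 0 le_rfl)
  have hb0 : 0 < b := (hg.pos le_rfl).trans_le (hb 0 le_rfl)
  have hab : (0 : ℝ × ℝ) ≤ (a, b) := ⟨ha0.le, hb0.le⟩
  have hma : m ≤ a := (hfm 0 le_rfl hab).trans (ha 0 le_rfl)
  have hlb : l ≤ b := (hgl 0 le_rfl hab).trans (hb 0 le_rfl)
  have hmaps : Set.MapsTo (fun u => logPair (f (expPair u), g (expPair u)))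
      (Set.Icc (logPair (m, l)) (logPair (a, b))) (Set.Icc (logPair (m, l)) (logPair (a, b))) := by
    intro u hu
    have hu0 := expPair_nonneg u
    have hule : expPair u ≤ (a, b) :=
      ⟨(Real.le_log_iff_exp_le ha0).1 hu.2.1, (Real.le_log_iff_exp_le hb0).1 hu.2.2⟩
    exact ⟨⟨Real.log_le_log hm (hfm _ hu0 hule), Real.log_le_log hl (hgl _ hu0 hule)⟩,
      ⟨Real.log_le_log (hf.pos hu0) (ha _ hu0), Real.log_le_log (hg.pos hu0) (hb _ hu0)⟩⟩
  have hle : logPair (m, l) ≤ logPair (a, b) := ⟨Real.log_le_log hm hma, Real.log_le_log hl hlb⟩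
  obtain ⟨u, -, hu⟩ := exists_fixedPt_of_dist_lt isCompact_Icc (Set.nonempty_Icc.2 hle) hmaps
    fun x _ y _ hxy => hf.dist_logPair_lt hg hxy
  refine ⟨expPair u, Real.exp_pos _, Real.exp_pos _, ?_⟩
  conv_rhs => rw [← hu.eq]
  exact (expPair_logPair (hf.pos (expPair_nonneg u)) (hg.pos (expPair_nonneg u))).symm

lemma eq_zero_of_fderiv_eq (hf : LogContracting f) (hg : LogContracting g) (hz₁ : 0 < z.1)
    (hz₂ : 0 < z.2) (hz : (f z, g z) = z) {v : ℝ × ℝ}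
    (hv : (fderiv ℝ f z v, fderiv ℝ g z v) = v) : v = 0 := by
  obtain ⟨w, rfl⟩ : ∃ w, v = z * w :=
    ⟨v / z, Prod.ext (mul_div_cancel₀ _ hz₁.ne').symm (mul_div_cancel₀ _ hz₂.ne').symm⟩
  by_contra hne
  have hw : w ≠ 0 := fun h => hne (by rw [h, mul_zero])
  have h₁ := (hf z ⟨hz₁.le, hz₂.le⟩).2 w hw
  have h₂ := (hg z ⟨hz₁.le, hz₂.le⟩).2 w hw
  obtain ⟨hz₁', hz₂'⟩ := Prod.ext_iff.1 hz
  obtain ⟨hv₁, hv₂⟩ := Prod.ext_iff.1 hv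
  dsimp only at hz₁' hz₂' hv₁ hv₂
  rw [hv₁, hz₁', Prod.fst_mul, abs_mul, abs_of_pos hz₁,
    mul_lt_mul_iff_right₀ hz₁] at h₁
  rw [hv₂, hz₂', Prod.snd_mul, abs_mul, abs_of_pos hz₂,
    mul_lt_mul_iff_right₀ hz₂] at h₂
  exact (max_lt h₁ h₂).false

end LogContracting

end LogContracting

theorem contDiffAt_of_fixedPoint {𝕜 E F : Type*} [RCLike 𝕜] [NormedAddCommGroup E]
    [NormedSpace 𝕜 E] [CompleteSpace E] [NormedAddCommGroup F] [NormedSpace 𝕜 F]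
    [FiniteDimensional 𝕜 F] {n : WithTop ℕ∞} {G : E × F → F} {ψ : E → F} {e : E}
    (hG : ContDiffAt 𝕜 n G (e, ψ e)) (hn : n ≠ 0) (hfix : G (e, ψ e) = ψ e)
    (huniq : ∀ᶠ p in 𝓝 (e, ψ e), G p = p.2 → p.2 = ψ p.1)
    (hker : ∀ v, fderiv 𝕜 (fun z => G (e, z)) (ψ e) v = v → v = 0) :
    ContDiffAt 𝕜 n ψ e := by
  have := FiniteDimensional.complete 𝕜 F
  have hH : ContDiffAt 𝕜 n (fun p : E × F => G p - p.2) (e, ψ e) := hG.sub contDiffAt_snd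
  have hpart (v : F) : fderiv 𝕜 (fun p : E × F => G p - p.2) (e, ψ e) (0, v) =
      fderiv 𝕜 (fun z => G (e, z)) (ψ e) v - v := by
    have hd := (hG.differentiableAt hn).hasFDerivAt
    have hz : HasFDerivAt (fun z => G (e, z)) _ (ψ e) :=
      hd.comp (ψ e) (hasFDerivAt_prodMk_right e _)
    rw [(hd.fun_sub hasFDerivAt_snd).fderiv, hz.fderiv]
    rfl
  have hinv : (fderiv 𝕜 (fun p : E × F => G p - p.2) (e, ψ e) ∘L
      ContinuousLinearMap.inr 𝕜 E F).IsInvertible := by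
    let L := fderiv 𝕜 (fun p : E × F => G p - p.2) (e, ψ e) ∘L ContinuousLinearMap.inr 𝕜 E F
    have hinj : Function.Injective (L : F →ₗ[𝕜] F) :=
      (injective_iff_map_eq_zero _).2 fun v hv => hker v (sub_eq_zero.1 ((hpart v).symm.trans hv))
    exact ⟨(LinearEquiv.ofInjectiveEndo _ hinj).toContinuousLinearEquiv, by ext; rfl⟩
  have hφ := hH.contDiffAt_implicitFunction hn hinv
  have hlim : Filter.Tendsto (fun x => (x, hH.implicitFunction hn hinv x)) (𝓝 e)
      (𝓝 (e, ψ e)) := by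
    simpa only [hH.implicitFunction_apply_self hn hinv] using
      ((continuousAt_id' e).prodMk hφ.continuousAt).tendsto
  refine hφ.congr_of_eventuallyEq ?_
  filter_upwards [hH.eventually_apply_implicitFunction hn hinv, hlim.eventually huniq] with x hx hu
  exact (hu (by simpa [hfix, sub_eq_zero] using hx)).symm

section Pencil

lemma posDef_one_add_smul {𝕜 ι : Type*} [RCLike 𝕜] [DecidableEq ι] {P : Matrix ι ι 𝕜}
    (hP : P.PosSemidef) {x : ℝ} (hx : 0 ≤ x) : (1 + x • P).PosDef :=
  Matrix.PosDef.one.add_posSemidef (hP.smul hx)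

variable {𝕜 ι κ : Type*} [RCLike 𝕜] [DecidableEq ι] [Fintype κ] [DecidableEq κ]

/-- The matrix `s (I + z₂ P) + A (I + z₁ Q)⁻¹ Aᴴ`, of which both `Γ` and `Γ̃` are inverses. -/
def pencil (s : ℝ) (P : Matrix ι ι 𝕜) (Q : Matrix κ κ 𝕜) (A : Matrix ι κ 𝕜) (z : ℝ × ℝ) :
    Matrix ι ι 𝕜 :=
  s • (1 + z.2 • P) + A * (1 + z.1 • Q)⁻¹ * Aᴴ

variable {s : ℝ} {P : Matrix ι ι 𝕜} {Q : Matrix κ κ 𝕜} {A : Matrix ι κ 𝕜} {z : ℝ × ℝ}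

lemma posDef_pencil [Finite ι] (hs : 0 < s) (hP : P.PosSemidef) (hQ : Q.PosSemidef)
    (A : Matrix ι κ 𝕜) (hz : 0 ≤ z) : (pencil s P Q A z).PosDef :=
  ((posDef_one_add_smul hP hz.2).smul hs).add_posSemidef
    ((posDef_one_add_smul hQ hz.1).inv.posSemidef.mul_mul_conjTranspose_same A)

lemma pencil_eq_add (hQ : Q.PosSemidef) (hz : 0 ≤ z.1) :
    pencil s P Q A z = z.1 • (A * ((1 + z.1 • Q)⁻¹ * Q * (1 + z.1 • Q)⁻¹) * Aᴴ) +
      (z.2 * s) • P + (s • 1 + A * ((1 + z.1 • Q)⁻¹ * (1 + z.1 • Q)⁻¹) * Aᴴ) := by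
  have hdet := (Matrix.isUnit_iff_isUnit_det _).1 (posDef_one_add_smul hQ hz).isUnit
  set V := (1 + z.1 • Q)⁻¹ with hV
  have hsplit : V = z.1 • (V * Q * V) + V * V := by
    calc V = V * (1 + z.1 • Q) * V := by rw [hV, Matrix.nonsing_inv_mul _ hdet, one_mul]
      _ = z.1 • (V * Q * V) + V * V := by
        rw [mul_add, add_mul, mul_one, mul_smul_comm, smul_mul_assoc, add_comm]
  conv_lhs => rw [pencil, ← hV, hsplit]
  rw [Matrix.mul_add, Matrix.add_mul, Matrix.mul_smul, Matrix.smul_mul, smul_add, smul_smul,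
    mul_comm s]
  abel

variable [Fintype ι] {c : ℝ}

/-- The function `z ↦ c Re tr (P (pencil z)⁻¹)`: both right-hand sides of the fixed-point system
have this form. -/
def traceFun (c s : ℝ) (P : Matrix ι ι 𝕜) (Q : Matrix κ κ 𝕜) (A : Matrix ι κ 𝕜) (z : ℝ × ℝ) : ℝ :=
  c * RCLike.re (P * (pencil s P Q A z)⁻¹).trace

lemma traceFun_le (hc : 0 ≤ c) (hs : 0 < s) (hP : P.PosSemidef) (hQ : Q.PosSemidef)
    (A : Matrix ι κ 𝕜) (hz : 0 ≤ z) : traceFun c s P Q A z ≤ c * (s⁻¹ * RCLike.re P.trace) := by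
  have hsub : (pencil s P Q A z - s • 1).PosSemidef := by
    have hsum := ((hP.smul hz.2).smul hs.le).add
      ((posDef_one_add_smul hQ hz.1).inv.posSemidef.mul_mul_conjTranspose_same A)
    convert hsum using 1
    rw [pencil, smul_add]
    abel
  exact mul_le_mul_of_nonneg_left
    (re_trace_mul_inv_le hs hP (posDef_pencil hs hP hQ A hz) hsub) hc

attribute [local instance] Matrix.linftyOpNormedAddCommGroup Matrix.linftyOpNormedSpace

lemma hasDerivAt_inv_pencil {A : ℝ → Matrix ι κ 𝕜} {z : ℝ → ℝ × ℝ} {y' t : ℝ} {Ξ' : Matrix ι ι 𝕜}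
    (hs : 0 < s) (hP : P.PosSemidef) (hQ : Q.PosSemidef) (hz : 0 ≤ z t)
    (hy : HasDerivAt (fun u => (z u).2) y' t)
    (hΞ : HasDerivAt (fun u => A u * (1 + (z u).1 • Q)⁻¹ * (A u)ᴴ) Ξ' t) :
    HasDerivAt (fun u => (pencil s P Q (A u) (z u))⁻¹)
      (-((pencil s P Q (A t) (z t))⁻¹ * ((s * y') • P + Ξ') * (pencil s P Q (A t) (z t))⁻¹)) t := by
  have hK := (((hy.smul_const P).const_add 1).const_smul s).add hΞ
  rw [smul_smul] at hK
  exact hasDerivAt_matrix_inv hK (posDef_pencil hs hP hQ (A t) hz).isUnit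

lemma contDiffAt_inv_pencil {E : Type*} [NormedAddCommGroup E] [NormedSpace ℝ E]
    {A : E → Matrix ι κ 𝕜} {z : E → ℝ × ℝ} {e : E} {n : WithTop ℕ∞} (hs : 0 < s)
    (hP : P.PosSemidef) (hQ : Q.PosSemidef) (hA : ContDiffAt ℝ n A e) (hz : ContDiffAt ℝ n z e)
    (hz0 : 0 ≤ z e) : ContDiffAt ℝ n (fun u => (pencil s P Q (A u) (z u))⁻¹) e := by
  have hV : ContDiffAt ℝ n (fun u => (1 + (z u).1 • Q)⁻¹) e :=
    contDiffAt_matrix_inv (contDiffAt_const.add (hz.fst.smul contDiffAt_const))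
      (posDef_one_add_smul hQ hz0.1).isUnit
  have hΦ : ContDiffAt ℝ n (fun u => 1 + (z u).2 • P) e :=
    contDiffAt_const.add (hz.snd.smul contDiffAt_const)
  exact contDiffAt_matrix_inv ((hΦ.const_smul s).add
    (contDiffAt_matrix_mul (contDiffAt_matrix_mul hA hV) (contDiffAt_conjTranspose hA)))
    (posDef_pencil hs hP hQ (A e) hz0).isUnit

lemma contDiffAt_traceFun {E : Type*} [NormedAddCommGroup E] [NormedSpace ℝ E]
    {A : E → Matrix ι κ 𝕜} {z : E → ℝ × ℝ} {e : E} {n : WithTop ℕ∞} (c : ℝ) (hs : 0 < s)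
    (hP : P.PosSemidef) (hQ : Q.PosSemidef) (hA : ContDiffAt ℝ n A e) (hz : ContDiffAt ℝ n z e)
    (hz0 : 0 ≤ z e) : ContDiffAt ℝ n (fun u => traceFun c s P Q (A u) (z u)) e :=
  contDiffAt_const.mul ((RCLike.reCLM (K := 𝕜)).contDiff.contDiffAt.comp e
    (contDiffAt_trace (contDiffAt_matrix_mul contDiffAt_const
      (contDiffAt_inv_pencil hs hP hQ hA hz hz0))))

lemma fderiv_traceFun (hs : 0 < s) (hP : P.PosSemidef) (hQ : Q.PosSemidef)
    (hz : 0 ≤ z) (v : ℝ × ℝ) :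
    fderiv ℝ (traceFun c s P Q A) z v =
      c * (v.1 * RCLike.re (P * ((pencil s P Q A z)⁻¹ *
          (A * ((1 + z.1 • Q)⁻¹ * Q * (1 + z.1 • Q)⁻¹) * Aᴴ) * (pencil s P Q A z)⁻¹)).trace -
        v.2 * (s * RCLike.re (P * ((pencil s P Q A z)⁻¹ * P * (pencil s P Q A z)⁻¹)).trace)) := by
  have hz' : HasDerivAt (fun t : ℝ => z + t • v) v 0 := by
    simpa using ((hasDerivAt_id (0 : ℝ)).smul_const v).const_add z
  have hdiff : DifferentiableAt ℝ (traceFun c s P Q A) z :=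
    (contDiffAt_traceFun c hs hP hQ contDiffAt_const contDiffAt_id hz).differentiableAt one_ne_zero
  have hV := hasDerivAt_inv_one_add_smul hz'.fst
    (by simpa using (posDef_one_add_smul hQ hz.1).isUnit)
  have hΞ : HasDerivAt (fun t : ℝ => A * (1 + (z + t • v).1 • Q)⁻¹ * Aᴴ)
      (A * -((1 + z.1 • Q)⁻¹ * (v.1 • Q) * (1 + z.1 • Q)⁻¹) * Aᴴ) 0 := by
    simpa using hasDerivAt_matrix_mul (hasDerivAt_matrix_mul (hasDerivAt_const 0 A) hV)
      (hasDerivAt_const 0 Aᴴ)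
  have hR := hasDerivAt_inv_pencil hs hP hQ (by simpa using hz) hz'.snd hΞ
  have htr := hasDerivAt_trace (hasDerivAt_matrix_mul (hasDerivAt_const 0 P) hR)
  have hf := ((RCLike.reCLM (K := 𝕜)).hasFDerivAt.comp_hasDerivAt 0 htr).const_mul c
  refine HasDerivAt.unique (hdiff.hasFDerivAt.hasLineDerivAt v) (hf.congr_deriv ?_)
  simp only [zero_smul, add_zero, zero_mul, zero_add, RCLike.reCLM_apply, mul_neg, neg_mul, mul_add,
    add_mul, Matrix.mul_smul, Matrix.smul_mul, Matrix.mul_neg, Matrix.neg_mul, neg_add,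
    Matrix.trace_add, Matrix.trace_neg, Matrix.trace_smul, map_add, map_neg, RCLike.smul_re]
  ring

-- The left side is `x |∂f/∂x| + y |∂f/∂y|` for `f = Re tr (P R)`, `R = K⁻¹`, `K = pencil z`,
-- `z = (x, y)`: in `R = R K R`, the first two terms of `K` in `pencil_eq_add` contribute exactly
-- these two summands, and the remaining one is positive definite.
lemma re_trace_mul_inv_pencil_gt (hs : 0 < s) (hP : P.PosSemidef) (hP0 : P ≠ 0)
    (hQ : Q.PosSemidef) (A : Matrix ι κ 𝕜) (hz : 0 ≤ z) :
    z.1 * RCLike.re (P * ((pencil s P Q A z)⁻¹ *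
          (A * ((1 + z.1 • Q)⁻¹ * Q * (1 + z.1 • Q)⁻¹) * Aᴴ) * (pencil s P Q A z)⁻¹)).trace +
        z.2 * (s * RCLike.re (P * ((pencil s P Q A z)⁻¹ * P * (pencil s P Q A z)⁻¹)).trace) <
      RCLike.re (P * (pencil s P Q A z)⁻¹).trace := by
  have hK := posDef_pencil hs hP hQ A hz
  have hVH := (posDef_one_add_smul hQ hz.1).inv.isHermitian.eq
  have hdecomp := pencil_eq_add (s := s) (P := P) (A := A) hQ hz.1
  have hdet := (Matrix.isUnit_iff_isUnit_det _).1 hK.isUnit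
  set V := (1 + z.1 • Q)⁻¹
  set R := (pencil s P Q A z)⁻¹ with hR
  have hRH : Rᴴ = R := hK.inv.isHermitian.eq
  have hW : (s • 1 + A * (V * V) * Aᴴ).PosDef := by
    have hVV := (Matrix.posSemidef_self_mul_conjTranspose V).mul_mul_conjTranspose_same A
    rw [hVH] at hVV
    exact (Matrix.PosDef.one.smul hs).add_posSemidef hVV
  have hRW : (R * (s • 1 + A * (V * V) * Aᴴ) * R).PosDef := by
    simpa only [Matrix.star_eq_conjTranspose, hRH] using
      (Matrix.IsUnit.posDef_star_right_conjugate_iff (U := R) hK.inv.isUnit).2 hW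
  have hRK : R = z.1 • (R * (A * (V * Q * V) * Aᴴ) * R) + z.2 • s • (R * P * R)
      + R * (s • 1 + A * (V * V) * Aᴴ) * R := by
    calc R = R * pencil s P Q A z * R := by rw [hR, Matrix.nonsing_inv_mul _ hdet, one_mul]
      _ = _ := by
        rw [hdecomp]
        simp only [mul_add, add_mul, mul_smul_comm, smul_mul_assoc, mul_one, smul_smul]
  have hpos := re_trace_mul_pos hP hP0 hRW
  conv_rhs => rw [hRK]
  simp only [mul_add P, mul_smul_comm, Matrix.trace_add, Matrix.trace_smul, map_add,
    RCLike.smul_re] at hpos ⊢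
  linarith

theorem logContracting_traceFun (hc : 0 < c) (hs : 0 < s) (hP : P.PosSemidef) (hP0 : P ≠ 0)
    (hQ : Q.PosSemidef) (A : Matrix ι κ 𝕜) : LogContracting (traceFun c s P Q A) := by
  intro z hz
  refine ⟨(contDiffAt_traceFun c hs hP hQ contDiffAt_const contDiffAt_id hz).differentiableAt
    one_ne_zero, fun w hw => ?_⟩
  have hlt := re_trace_mul_inv_pencil_gt hs hP hP0 hQ A hz
  have hRH := (posDef_pencil hs hP hQ A hz).inv.isHermitian.eq
  have hVH := (posDef_one_add_smul hQ hz.1).inv.isHermitian.eq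
  rw [fderiv_traceFun hs hP hQ hz, traceFun, mul_assoc c, abs_mul, abs_of_pos hc]
  set R := (pencil s P Q A z)⁻¹
  set V := (1 + z.1 • Q)⁻¹
  have hVQV : (V * Q * V).PosSemidef := by
    simpa only [hVH] using hQ.mul_mul_conjTranspose_same V
  have ha : 0 ≤ RCLike.re (P * (R * (A * (V * Q * V) * Aᴴ) * R)).trace :=
    re_trace_mul_nonneg hP (by
      simpa only [hRH] using (hVQV.mul_mul_conjTranspose_same A).mul_mul_conjTranspose_same R)
  have hb : 0 ≤ s * RCLike.re (P * (R * P * R)).trace :=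
    mul_nonneg hs.le (re_trace_mul_nonneg hP (by
      simpa only [hRH] using hP.mul_mul_conjTranspose_same R))
  set a := RCLike.re (P * (R * (A * (V * Q * V) * Aᴴ) * R)).trace
  set b := s * RCLike.re (P * (R * P * R)).trace
  refine mul_lt_mul_of_pos_left ?_ hc
  calc |z.1 * w.1 * a - z.2 * w.2 * b| ≤ |z.1 * w.1 * a| + |z.2 * w.2 * b| := abs_sub _ _
    _ = z.1 * a * ‖w.1‖ + z.2 * b * ‖w.2‖ := by
      rw [abs_mul, abs_mul, abs_mul, abs_mul, abs_of_nonneg hz.1, abs_of_nonneg hz.2,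
        abs_of_nonneg ha, abs_of_nonneg hb, Real.norm_eq_abs, Real.norm_eq_abs]
      ring
    _ ≤ z.1 * a * ‖w‖ + z.2 * b * ‖w‖ :=
      add_le_add (mul_le_mul_of_nonneg_left (norm_fst_le w) (mul_nonneg hz.1 ha))
        (mul_le_mul_of_nonneg_left (norm_snd_le w) (mul_nonneg hz.2 hb))
    _ < RCLike.re (P * R).trace * ‖w‖ := by
      rw [← add_mul]
      exact mul_lt_mul_of_pos_right hlt (norm_pos_iff.2 hw)

end Pencil

section Update

variable {N : ℕ} {f : Positions N → ℝ} {T : Positions N} {n : Fin N}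

lemma differentiableAt_comp_update (hf : DifferentiableAt ℝ f T) :
    DifferentiableAt ℝ (fun t => f (Function.update T n t)) (T n) :=
  ((Function.update_eq_self n T).symm ▸ hf).comp (T n) (hasFDerivAt_update T (T n)).differentiableAt

lemma gradient_comp_update_apply {r : ℝ} {i : Fin 2} (hf : DifferentiableAt ℝ f T)
    (hr : HasLineDerivAt ℝ f r T (coordDir n i)) :
    gradient (fun t => f (Function.update T n t)) (T n) i = r := by
  have hf' : HasFDerivAt f (fderiv ℝ f T) (Function.update T n (T n)) :=
    (Function.update_eq_self n T).symm ▸ hf.hasFDerivAt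
  have hcomp : HasFDerivAt (fun t => f (Function.update T n t)) _ (T n) :=
    hf'.comp (T n) (hasFDerivAt_update T (T n))
  have hdir : ContinuousLinearMap.pi (Pi.single n (.id ℝ (EuclideanSpace ℝ (Fin 2))))
      (EuclideanSpace.single i 1) = coordDir n i := by
    ext m
    rcases eq_or_ne m n with rfl | hm <;> simp [coordDir, *]
  calc gradient (fun t => f (Function.update T n t)) (T n) i
      = inner ℝ (gradient (fun t => f (Function.update T n t)) (T n))
          (EuclideanSpace.single i 1) := by rw [EuclideanSpace.inner_single_right, one_mul]; rfl
    _ = fderiv ℝ f T (coordDir n i) := by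
      rw [inner_gradient_left, hcomp.fderiv, ContinuousLinearMap.comp_apply, hdir]
    _ = r := (hf.hasFDerivAt.hasLineDerivAt _).unique hr

end Update

section System

attribute [local instance] Matrix.linftyOpNormedAddCommGroup Matrix.linftyOpNormedSpace

lemma HasMatrixPartial.of_hasLineDerivAt {N M : ℕ} {A : Positions N → Matrix (Fin M) (Fin M) ℂ}
    {A' : Matrix (Fin M) (Fin M) ℂ} {T : Positions N} {n : Fin N} {i : Fin 2}
    (h : HasLineDerivAt ℝ A A' T (coordDir n i)) : HasMatrixPartial A A' T n i :=
  fun a b => hasDerivAt_matrix_iff.1 h a b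

namespace System

variable {N M : ℕ} (S : System N M)

/-- The standing assumptions on the data of the system. -/
structure Admissible : Prop where
  sigma_pos : 0 < S.σ
  beta_pos : ∀ m, 0 < S.β m
  K_nonneg : ∀ m, 0 ≤ S.K m
  F_ne_zero : S.F ≠ 0

/-- The right-hand side `(1/M) tr (D Γ)` of the equation for `δ`, as a real function of
`z = (δ, δ̃)`. -/
def rhsDelta (T : Positions N) : ℝ × ℝ → ℝ :=
  traceFun (1 / M) (S.σ ^ 2) S.D S.Dt (S.B T)

/-- The right-hand side `(1/M) tr (D̃ Γ̃)` of the equation for `δ̃`, as a real function of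
`z = (δ, δ̃)`. -/
def rhsDeltat (T : Positions N) (z : ℝ × ℝ) : ℝ :=
  traceFun (1 / M) (S.σ ^ 2) S.Dt S.D (S.B T)ᴴ z.swap

lemma posSemidef_Dt : S.Dt.PosSemidef :=
  Matrix.PosSemidef.diagonal fun _ => Complex.zero_le_real.2
    (Finset.sum_nonneg fun _ _ => sq_nonneg _)

lemma PhiOf_eq (y : ℝ) : S.PhiOf y = (1 + y • S.D)⁻¹ := by
  rw [PhiOf, RCLike.real_smul_eq_coe_smul (K := ℂ) y]
  rfl

lemma PhitOf_eq (x : ℝ) : S.PhitOf x = (1 + x • S.Dt)⁻¹ := by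
  rw [PhitOf, RCLike.real_smul_eq_coe_smul (K := ℂ) x]
  rfl

lemma inv_PhitOf {x : ℝ} (hx : 0 ≤ x) : (S.PhitOf x)⁻¹ = 1 + x • S.Dt := by
  rw [PhitOf_eq, Matrix.nonsing_inv_nonsing_inv _
    ((Matrix.isUnit_iff_isUnit_det _).1 (posDef_one_add_smul S.posSemidef_Dt hx).isUnit)]

lemma GamtOf_eq (T : Positions N) {z : ℝ × ℝ} (hz : 0 ≤ z) :
    S.GamtOf T z.1 z.2 = (pencil (S.σ ^ 2) S.Dt S.D (S.B T)ᴴ z.swap)⁻¹ := by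
  rw [GamtOf, S.inv_PhitOf hz.1, PhiOf_eq, pencil, RCLike.real_smul_eq_coe_smul (K := ℂ) (S.σ ^ 2)]
  simp

section Channel

lemma conjTranspose_GLoS_apply (T : Positions N) (m : Fin M) (n : Fin N) :
    (S.GLoS T)ᴴ m n = Complex.exp
      (-Complex.I * ((2 * Real.pi / S.lam * ∑ k, T n k * S.rho m k : ℝ) : ℂ)) := by
  simp only [GLoS, Matrix.conjTranspose_apply, Matrix.of_apply, Complex.star_def,
    ← Complex.exp_conj, map_mul, Complex.conj_I, Complex.conj_ofReal]

lemma contDiff_conjTranspose_GLoS : ContDiff ℝ ω fun T => (S.GLoS T)ᴴ :=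
  contDiff_iff_contDiffAt.2 fun T => contDiffAt_matrix_iff.2 fun m n => by
    simp only [conjTranspose_GLoS_apply]
    have hphase : ContDiff ℝ ω fun T : Positions N =>
        2 * Real.pi / S.lam * ∑ k, T n k * S.rho m k := by fun_prop
    exact (contDiff_const.mul (Complex.ofRealCLM.contDiff.comp hphase)).cexp.contDiffAt

lemma contDiff_B : ContDiff ℝ ω S.B :=
  contDiff_iff_contDiffAt.2 fun _ => contDiffAt_matrix_mul
    (contDiffAt_matrix_mul contDiffAt_const S.contDiff_conjTranspose_GLoS.contDiffAt)
    contDiffAt_const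

variable (T : Positions N) (n : Fin N) (i : Fin 2)

lemma hasLineDerivAt_conjTranspose_GLoS :
    HasLineDerivAt ℝ (fun T' => (S.GLoS T')ᴴ)
      (Matrix.vecMulVec (S.gtDeriv T n i) (Pi.single n 1)) T (coordDir n i) :=
  hasDerivAt_matrix_iff.2 fun m k => by
    have hphase : HasDerivAt (fun u : ℝ => 2 * Real.pi / S.lam *
        ∑ l, (T + u • coordDir n i) k l * S.rho m l)
        (2 * Real.pi / S.lam * ∑ l, coordDir n i k l * S.rho m l) 0 := by
      refine HasDerivAt.const_mul _ (HasDerivAt.fun_sum fun l _ => HasDerivAt.mul_const ?_ _)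
      simpa using ((hasDerivAt_id (0 : ℝ)).mul_const (coordDir n i k l)).const_add (T k l)
    simp only [conjTranspose_GLoS_apply]
    refine ((hphase.ofReal_comp.const_mul (-Complex.I)).cexp).congr_deriv ?_
    rw [zero_smul, add_zero, Matrix.vecMulVec_apply, gtDeriv, mul_comm (Complex.exp _)]
    rcases eq_or_ne k n with rfl | hk
    · have hcoord : ∑ l, coordDir k i k l * S.rho m l = S.rho m i := by simp [coordDir]
      rw [hcoord, Pi.single_eq_same, mul_one]
    · simp [coordDir, hk]

lemma hasLineDerivAt_conjTranspose_GLoS_apply (m : Fin M) :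
    HasLineDerivAt ℝ (fun T' => (S.GLoS T')ᴴ m n) (S.gtDeriv T n i m) T (coordDir n i) := by
  have hentry := hasDerivAt_matrix_iff.1 (S.hasLineDerivAt_conjTranspose_GLoS T n i) m n
  rwa [Matrix.vecMulVec_apply, Pi.single_eq_same, mul_one] at hentry

lemma hasLineDerivAt_B :
    HasLineDerivAt ℝ S.B
      (S.sqrtLambda * Matrix.vecMulVec (S.gtDeriv T n i) (Pi.single n 1) * S.F) T
      (coordDir n i) := by
  refine (hasDerivAt_matrix_mul (hasDerivAt_matrix_mul (hasDerivAt_const 0 S.sqrtLambda)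
    (S.hasLineDerivAt_conjTranspose_GLoS T n i)) (hasDerivAt_const 0 S.F)).congr_deriv ?_
  simp

end Channel

lemma Phi_eq (T : Positions N) : S.Phi T = (1 + S.deltat T • S.D)⁻¹ := S.PhiOf_eq _

lemma Phit_eq (T : Positions N) : S.Phit T = (1 + S.delta T • S.Dt)⁻¹ := S.PhitOf_eq _

section Partial

variable (T : Positions N) (n : Fin N) (i : Fin 2)

/-- `δ'_{(n,i)}`, the partial derivative of `δ` with respect to `t_{n,i}`. -/
def partialDelta : ℝ := lineDeriv ℝ S.delta T (coordDir n i)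

/-- `δ̃'_{(n,i)}`, the partial derivative of `δ̃` with respect to `t_{n,i}`. -/
def partialDeltat : ℝ := lineDeriv ℝ S.deltat T (coordDir n i)

/-- `Φ'_{(n,i)}`, given by its closed form. -/
def partialPhi : Matrix (Fin M) (Fin M) ℂ :=
  -(S.Phi T * ((S.partialDeltat T n i : ℂ) • S.D) * S.Phi T)

/-- `Φ̃'_{(n,i)}`, given by its closed form. -/
def partialPhit : Matrix (Fin M) (Fin M) ℂ :=
  -(S.Phit T * ((S.partialDelta T n i : ℂ) • S.Dt) * S.Phit T)

/-- `Ξ'_{(n,i)}`, given by its closed form. -/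
def partialXi : Matrix (Fin M) (Fin M) ℂ :=
  S.B T * S.partialPhit T n i * (S.B T)ᴴ
    + twoRe (S.sqrtLambda * Matrix.vecMulVec (S.gtDeriv T n i) (Pi.single n (1 : ℂ)) *
        S.F * S.Phit T * (S.B T)ᴴ)

/-- `Ξ̃'_{(n,i)}`, given by its closed form. -/
def partialXit : Matrix (Fin M) (Fin M) ℂ :=
  (S.B T)ᴴ * S.partialPhi T n i * S.B T
    + twoRe ((S.B T)ᴴ * S.Phi T * S.sqrtLambda *
        Matrix.vecMulVec (S.gtDeriv T n i) (Pi.single n (1 : ℂ)) * S.F)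

/-- `Γ'_{(n,i)}`, given by its closed form. -/
def partialGam : Matrix (Fin M) (Fin M) ℂ :=
  -(S.Gam T * (((S.σ : ℂ) ^ 2 * (S.partialDeltat T n i : ℂ)) • S.D + S.partialXi T n i) * S.Gam T)

/-- `Γ̃'_{(n,i)}`, given by its closed form. -/
def partialGamt : Matrix (Fin M) (Fin M) ℂ :=
  -(S.Gamt T * (((S.σ : ℂ) ^ 2 * (S.partialDelta T n i : ℂ)) • S.Dt + S.partialXit T n i) *
    S.Gamt T)

end Partial

lemma rate_eq (T : Positions N) :
    S.rate T = -Real.log (RCLike.re (S.σ ^ 2 • S.Gam T).det)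
      + Real.log (RCLike.re (1 + S.delta T • S.Dt).det)
      - S.σ ^ 2 * M * (S.delta T * S.deltat T) := by
  simp only [rate, RCLike.real_smul_eq_coe_smul (K := ℂ), ← Complex.ofReal_pow, ← mul_assoc]
  rfl

namespace Admissible

variable {S} (h : S.Admissible)

include h

lemma M_pos : 0 < M := by
  by_contra hM
  obtain rfl : M = 0 := by omega
  exact h.F_ne_zero (Subsingleton.elim _ _)

lemma one_div_M_pos : (0 : ℝ) < 1 / M := one_div_pos.2 (Nat.cast_pos.2 h.M_pos)

lemma posDef_D : S.D.PosDef :=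
  Matrix.PosDef.diagonal fun m => Complex.zero_lt_real.2 <| div_pos
    (mul_pos (Nat.cast_pos.2 h.M_pos) (h.beta_pos m)) (by linarith [h.K_nonneg m])

lemma D_ne_zero : S.D ≠ 0 := by
  have : Nonempty (Fin M) := ⟨⟨0, h.M_pos⟩⟩
  intro hzero
  simpa [hzero] using h.posDef_D.trace_pos

lemma Dt_ne_zero : S.Dt ≠ 0 := by
  refine fun hzero => h.F_ne_zero (Matrix.ext fun n k => ?_)
  have hsum : ∑ n, ‖S.F n k‖ ^ 2 = 0 := by
    simpa [Dt, ← Complex.ofReal_pow, ← Complex.ofReal_sum] using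
      congrFun (Matrix.diagonal_eq_zero.1 hzero) k
  simpa using (Finset.sum_eq_zero_iff_of_nonneg fun _ _ => sq_nonneg _).1 hsum n
    (Finset.mem_univ n)

lemma inv_PhiOf {y : ℝ} (hy : 0 ≤ y) : (S.PhiOf y)⁻¹ = 1 + y • S.D := by
  rw [PhiOf_eq, Matrix.nonsing_inv_nonsing_inv _
    ((Matrix.isUnit_iff_isUnit_det _).1 (posDef_one_add_smul h.posDef_D.posSemidef hy).isUnit)]

lemma GamOf_eq (T : Positions N) {z : ℝ × ℝ} (hz : 0 ≤ z) :
    S.GamOf T z.1 z.2 = (pencil (S.σ ^ 2) S.D S.Dt (S.B T) z)⁻¹ := by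
  rw [GamOf, h.inv_PhiOf hz.2, PhitOf_eq, pencil, RCLike.real_smul_eq_coe_smul (K := ℂ) (S.σ ^ 2)]
  simp

lemma sq_sigma_pos : 0 < S.σ ^ 2 := pow_pos h.sigma_pos 2

lemma ofReal_rhsDelta (T : Positions N) {z : ℝ × ℝ} (hz : 0 ≤ z) :
    (S.rhsDelta T z : ℂ) = 1 / (M : ℂ) * (S.D * S.GamOf T z.1 z.2).trace := by
  have hD := h.posDef_D.posSemidef
  rw [h.GamOf_eq T hz, ← ofReal_re_trace_mul hD.isHermitian
    (posDef_pencil h.sq_sigma_pos hD S.posSemidef_Dt (S.B T) hz).inv.isHermitian,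
    rhsDelta, traceFun]
  push_cast
  rfl

lemma ofReal_rhsDeltat (T : Positions N) {z : ℝ × ℝ} (hz : 0 ≤ z) :
    (S.rhsDeltat T z : ℂ) = 1 / (M : ℂ) * (S.Dt * S.GamtOf T z.1 z.2).trace := by
  have hDt := S.posSemidef_Dt
  rw [S.GamtOf_eq T hz, ← ofReal_re_trace_mul hDt.isHermitian
    (posDef_pencil h.sq_sigma_pos hDt h.posDef_D.posSemidef (S.B T)ᴴ hz.symm).inv.isHermitian,
    rhsDeltat, traceFun]
  push_cast
  rfl

lemma isPositiveSolution_iff {T : Positions N} {z : ℝ × ℝ} :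
    S.IsPositiveSolution T z ↔ 0 < z.1 ∧ 0 < z.2 ∧ (S.rhsDelta T z, S.rhsDeltat T z) = z := by
  refine and_congr_right fun hz₁ => and_congr_right fun hz₂ => ?_
  have hz : 0 ≤ z := ⟨hz₁.le, hz₂.le⟩
  rw [← h.ofReal_rhsDelta T hz, ← h.ofReal_rhsDeltat T hz, Prod.ext_iff, Complex.ofReal_inj,
    Complex.ofReal_inj, eq_comm, eq_comm (a := z.2)]

lemma logContracting_rhsDelta (T : Positions N) : LogContracting (S.rhsDelta T) :=
  logContracting_traceFun h.one_div_M_pos h.sq_sigma_pos h.posDef_D.posSemidef h.D_ne_zero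
    S.posSemidef_Dt (S.B T)

lemma logContracting_rhsDeltat (T : Positions N) : LogContracting (S.rhsDeltat T) :=
  (logContracting_traceFun h.one_div_M_pos h.sq_sigma_pos S.posSemidef_Dt h.Dt_ne_zero
    h.posDef_D.posSemidef (S.B T)ᴴ).comp_swap

lemma bddAbove_rhsDelta (T : Positions N) : BddAbove (S.rhsDelta T '' Set.Ici 0) :=
  ⟨_, Set.forall_mem_image.2 fun _ hz => traceFun_le h.one_div_M_pos.le h.sq_sigma_pos
    h.posDef_D.posSemidef S.posSemidef_Dt (S.B T) hz⟩

lemma bddAbove_rhsDeltat (T : Positions N) : BddAbove (S.rhsDeltat T '' Set.Ici 0) :=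
  ⟨_, Set.forall_mem_image.2 fun z hz => traceFun_le (z := z.swap) h.one_div_M_pos.le
    h.sq_sigma_pos S.posSemidef_Dt h.posDef_D.posSemidef (S.B T)ᴴ hz.symm⟩

lemma eq_of_isPositiveSolution {T : Positions N} {z w : ℝ × ℝ} (hz : S.IsPositiveSolution T z)
    (hw : S.IsPositiveSolution T w) : z = w := by
  obtain ⟨hz₁, hz₂, hz⟩ := h.isPositiveSolution_iff.1 hz
  obtain ⟨hw₁, hw₂, hw⟩ := h.isPositiveSolution_iff.1 hw
  exact (h.logContracting_rhsDelta T).eq_of_fixed (h.logContracting_rhsDeltat T)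
    hz₁ hz₂ hz hw₁ hw₂ hw

theorem existsUnique_isPositiveSolution (T : Positions N) :
    ∃! z : ℝ × ℝ, S.IsPositiveSolution T z := by
  obtain ⟨z, hz⟩ := (h.logContracting_rhsDelta T).exists_fixed (h.logContracting_rhsDeltat T)
    (h.bddAbove_rhsDelta T) (h.bddAbove_rhsDeltat T)
  have hsol := h.isPositiveSolution_iff.2 hz
  exact ⟨z, hsol, fun w hw => h.eq_of_isPositiveSolution hw hsol⟩

lemma isPositiveSolution_fixedPoint (T : Positions N) : S.IsPositiveSolution T (S.fixedPoint T) :=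
  Classical.epsilon_spec (h.existsUnique_isPositiveSolution T).exists

lemma fixedPoint_nonneg (T : Positions N) : 0 ≤ S.fixedPoint T :=
  ⟨(h.isPositiveSolution_fixedPoint T).1.le, (h.isPositiveSolution_fixedPoint T).2.1.le⟩

theorem contDiff_fixedPoint : ContDiff ℝ ω S.fixedPoint := by
  refine contDiff_iff_contDiffAt.2 fun T => ?_
  obtain ⟨hpos₁, hpos₂, hfix⟩ := h.isPositiveSolution_iff.1 (h.isPositiveSolution_fixedPoint T)
  have hz := h.fixedPoint_nonneg T
  have hB : ContDiffAt ℝ ω (fun p : Positions N × (ℝ × ℝ) => S.B p.1) (T, S.fixedPoint T) :=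
    S.contDiff_B.contDiffAt.comp _ contDiffAt_fst
  have hδ : ContDiffAt ℝ ω (fun p : Positions N × (ℝ × ℝ) => S.rhsDelta p.1 p.2)
      (T, S.fixedPoint T) :=
    contDiffAt_traceFun _ h.sq_sigma_pos h.posDef_D.posSemidef S.posSemidef_Dt hB
      contDiffAt_snd hz
  have hδt : ContDiffAt ℝ ω (fun p : Positions N × (ℝ × ℝ) => S.rhsDeltat p.1 p.2)
      (T, S.fixedPoint T) :=
    contDiffAt_traceFun _ h.sq_sigma_pos S.posSemidef_Dt h.posDef_D.posSemidef
      (contDiffAt_conjTranspose hB) (contDiffAt_snd.snd.prodMk contDiffAt_snd.fst) hz.symm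
  refine contDiffAt_of_fixedPoint (hδ.prodMk hδt) (by simp) hfix ?_ fun v hv => ?_
  · have hopen : ∀ᶠ z in 𝓝 (S.fixedPoint T), 0 < z.1 ∧ 0 < z.2 :=
      (continuous_fst.continuousAt.eventually_const_lt hpos₁).and
        (continuous_snd.continuousAt.eventually_const_lt hpos₂)
    filter_upwards [continuous_snd.continuousAt.eventually hopen] with p hp hpfix
    exact h.eq_of_isPositiveSolution (h.isPositiveSolution_iff.2 ⟨hp.1, hp.2, hpfix⟩)
      (h.isPositiveSolution_fixedPoint p.1)
  · have hf := h.logContracting_rhsDelta T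
    have hg := h.logContracting_rhsDeltat T
    refine hf.eq_zero_of_fderiv_eq hg hpos₁ hpos₂ hfix ?_
    rw [((hf _ hz).1.hasFDerivAt.prodMk (hg _ hz).1.hasFDerivAt).fderiv] at hv
    exact hv

lemma Gam_eq (T : Positions N) :
    S.Gam T = (pencil (S.σ ^ 2) S.D S.Dt (S.B T) (S.fixedPoint T))⁻¹ :=
  h.GamOf_eq T (h.fixedPoint_nonneg T)

lemma Gamt_eq (T : Positions N) :
    S.Gamt T = (pencil (S.σ ^ 2) S.Dt S.D (S.B T)ᴴ (S.fixedPoint T).swap)⁻¹ :=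
  S.GamtOf_eq T (h.fixedPoint_nonneg T)

lemma posDef_Gam (T : Positions N) : (S.Gam T).PosDef :=
  h.Gam_eq T ▸ (posDef_pencil h.sq_sigma_pos h.posDef_D.posSemidef S.posSemidef_Dt (S.B T)
    (h.fixedPoint_nonneg T)).inv

lemma posDef_one_add_deltat_smul_D (T : Positions N) : (1 + S.deltat T • S.D).PosDef :=
  posDef_one_add_smul h.posDef_D.posSemidef (h.fixedPoint_nonneg T).2

lemma posDef_one_add_delta_smul_Dt (T : Positions N) : (1 + S.delta T • S.Dt).PosDef :=
  posDef_one_add_smul S.posSemidef_Dt (h.fixedPoint_nonneg T).1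

section Partial

variable (T : Positions N) (n : Fin N) (i : Fin 2)

lemma hasLineDerivAt_delta :
    HasLineDerivAt ℝ S.delta (S.partialDelta T n i) T (coordDir n i) :=
  (h.contDiff_fixedPoint.fst.differentiable (by simp) T).lineDifferentiableAt.hasLineDerivAt

lemma hasLineDerivAt_deltat :
    HasLineDerivAt ℝ S.deltat (S.partialDeltat T n i) T (coordDir n i) :=
  (h.contDiff_fixedPoint.snd.differentiable (by simp) T).lineDifferentiableAt.hasLineDerivAt

lemma hasLineDerivAt_Phi :
    HasLineDerivAt ℝ S.Phi (S.partialPhi T n i) T (coordDir n i) := by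
  have hinv := hasDerivAt_inv_one_add_smul (h.hasLineDerivAt_deltat T n i)
    (h.posDef_one_add_deltat_smul_D _).isUnit
  simp only [← S.Phi_eq, RCLike.real_smul_eq_coe_smul (K := ℂ) (S.partialDeltat T n i), zero_smul,
    add_zero] at hinv
  exact hinv

lemma hasLineDerivAt_Phit :
    HasLineDerivAt ℝ S.Phit (S.partialPhit T n i) T (coordDir n i) := by
  have hinv := hasDerivAt_inv_one_add_smul (h.hasLineDerivAt_delta T n i)
    (h.posDef_one_add_delta_smul_Dt _).isUnit
  simp only [← S.Phit_eq, RCLike.real_smul_eq_coe_smul (K := ℂ) (S.partialDelta T n i), zero_smul,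
    add_zero] at hinv
  exact hinv

lemma hasLineDerivAt_Xi :
    HasLineDerivAt ℝ S.Xi (S.partialXi T n i) T (coordDir n i) := by
  have hHerm : (S.Phit (T + (0 : ℝ) • coordDir n i)).IsHermitian :=
    S.Phit_eq _ ▸ (h.posDef_one_add_delta_smul_Dt _).inv.isHermitian
  have hΞ := hasDerivAt_mul_mul_conjTranspose (S.hasLineDerivAt_B T n i)
    (h.hasLineDerivAt_Phit T n i) hHerm
  simp only [zero_smul, add_zero] at hΞ
  exact hΞ

lemma hasLineDerivAt_Xit :
    HasLineDerivAt ℝ S.Xit (S.partialXit T n i) T (coordDir n i) := by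
  have hHerm : (S.Phi T).IsHermitian :=
    S.Phi_eq _ ▸ (h.posDef_one_add_deltat_smul_D _).inv.isHermitian
  have hΞ := hasDerivAt_mul_mul_conjTranspose (hasDerivAt_conjTranspose
    (S.hasLineDerivAt_B T n i)) (h.hasLineDerivAt_Phi T n i) (by simpa using hHerm)
  simp only [Matrix.conjTranspose_conjTranspose] at hΞ
  refine hΞ.congr_deriv ?_
  simp only [zero_smul, add_zero, partialXit, twoRe, Matrix.conjTranspose_mul,
    Matrix.conjTranspose_conjTranspose, hHerm.eq, Matrix.mul_assoc]
  rw [add_comm (_ * (_ * (_ * (_ * _))))]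

lemma hasLineDerivAt_Gam :
    HasLineDerivAt ℝ S.Gam (S.partialGam T n i) T (coordDir n i) := by
  have hΞ := h.hasLineDerivAt_Xi T n i
  simp only [HasLineDerivAt, Xi, Phit_eq] at hΞ
  have hinv := hasDerivAt_inv_pencil h.sq_sigma_pos h.posDef_D.posSemidef S.posSemidef_Dt
    (h.fixedPoint_nonneg _) (h.hasLineDerivAt_deltat T n i) hΞ
  simp only [← h.Gam_eq, RCLike.real_smul_eq_coe_smul (K := ℂ) (S.σ ^ 2 * _), zero_smul,
    add_zero] at hinv
  refine hinv.congr_deriv ?_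
  simp [partialGam]

lemma hasLineDerivAt_Gamt :
    HasLineDerivAt ℝ S.Gamt (S.partialGamt T n i) T (coordDir n i) := by
  have hΞ := h.hasLineDerivAt_Xit T n i
  simp only [HasLineDerivAt, Xit, Phi_eq] at hΞ
  have hinv := hasDerivAt_inv_pencil (A := fun u : ℝ => (S.B (T + u • coordDir n i))ᴴ)
    (z := fun u : ℝ => (S.fixedPoint (T + u • coordDir n i)).swap) h.sq_sigma_pos S.posSemidef_Dt
    h.posDef_D.posSemidef (h.fixedPoint_nonneg _).symm (h.hasLineDerivAt_delta T n i)
    (by simp only [Matrix.conjTranspose_conjTranspose]; exact hΞ)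
  simp only [← h.Gamt_eq, RCLike.real_smul_eq_coe_smul (K := ℂ) (S.σ ^ 2 * _), zero_smul,
    add_zero] at hinv
  refine hinv.congr_deriv ?_
  simp [partialGamt]

theorem partialDelta_eq :
    (S.partialDelta T n i : ℂ) = 1 / (M : ℂ) * (S.D * S.partialGam T n i).trace := by
  have htrace := (hasDerivAt_trace (hasDerivAt_matrix_mul (hasDerivAt_const 0 S.D)
    (h.hasLineDerivAt_Gam T n i))).const_mul (1 / (M : ℂ))
  simp only [zero_mul, zero_add] at htrace
  refine HasDerivAt.unique (h.hasLineDerivAt_delta T n i).ofReal_comp ?_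
  exact htrace.congr_of_eventuallyEq (.of_forall fun _ =>
    (h.isPositiveSolution_fixedPoint _).2.2.1)

theorem partialDeltat_eq :
    (S.partialDeltat T n i : ℂ) = 1 / (M : ℂ) * (S.Dt * S.partialGamt T n i).trace := by
  have htrace := (hasDerivAt_trace (hasDerivAt_matrix_mul (hasDerivAt_const 0 S.Dt)
    (h.hasLineDerivAt_Gamt T n i))).const_mul (1 / (M : ℂ))
  simp only [zero_mul, zero_add] at htrace
  refine HasDerivAt.unique (h.hasLineDerivAt_deltat T n i).ofReal_comp ?_
  exact htrace.congr_of_eventuallyEq (.of_forall fun _ =>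
    (h.isPositiveSolution_fixedPoint _).2.2.2)

end Partial

lemma isHermitian_partialGam (T : Positions N) (n : Fin N) (i : Fin 2) :
    (S.partialGam T n i).IsHermitian :=
  isHermitian_of_hasDerivAt (h.hasLineDerivAt_Gam T n i) fun _ => (h.posDef_Gam _).isHermitian

lemma contDiff_Gam : ContDiff ℝ ω S.Gam := by
  rw [funext h.Gam_eq]
  exact contDiff_iff_contDiffAt.2 fun T => contDiffAt_inv_pencil h.sq_sigma_pos
    h.posDef_D.posSemidef S.posSemidef_Dt S.contDiff_B.contDiffAt
    h.contDiff_fixedPoint.contDiffAt (h.fixedPoint_nonneg T)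

theorem contDiff_rate : ContDiff ℝ ω S.rate := by
  have hδ : ContDiff ℝ ω S.delta := h.contDiff_fixedPoint.fst
  have hδt : ContDiff ℝ ω S.deltat := h.contDiff_fixedPoint.snd
  rw [funext S.rate_eq]
  refine ((contDiff_iff_contDiffAt.2 fun T => ?_).neg.add
    (contDiff_iff_contDiffAt.2 fun T => ?_)).sub (contDiff_const.mul (hδ.mul hδt))
  · exact contDiffAt_log_det_re (h.contDiff_Gam.contDiffAt.const_smul (S.σ ^ 2))
      ((h.posDef_Gam T).smul h.sq_sigma_pos)
  · exact contDiffAt_log_det_re (contDiffAt_const.add (hδ.contDiffAt.smul contDiffAt_const))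
      (h.posDef_one_add_delta_smul_Dt T)

lemma differentiable_rate : Differentiable ℝ S.rate := h.contDiff_rate.differentiable (by simp)

variable (T : Positions N) (n : Fin N) (i : Fin 2)

lemma hasLineDerivAt_rate :
    HasLineDerivAt ℝ S.rate
      (-RCLike.re ((S.Gam T)⁻¹ * S.partialGam T n i).trace
        + S.partialDelta T n i * RCLike.re (S.Phit T * S.Dt).trace
        - S.σ ^ 2 * M * (S.partialDelta T n i * S.deltat T + S.delta T * S.partialDeltat T n i))
      T (coordDir n i) := by
  have hδ := h.hasLineDerivAt_delta T n i
  have hGam := hasDerivAt_log_det_re ((h.hasLineDerivAt_Gam T n i).fun_const_smul (S.σ ^ 2))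
    ((h.posDef_Gam _).smul h.sq_sigma_pos)
  have hDt := hasDerivAt_log_det_re ((HasDerivAt.smul_const hδ S.Dt).const_add 1)
    (h.posDef_one_add_delta_smul_Dt _)
  have hrate := (hGam.neg.add hDt).sub
    ((HasDerivAt.mul hδ (h.hasLineDerivAt_deltat T n i)).const_mul (S.σ ^ 2 * M))
  have hinv : (S.σ ^ 2 • S.Gam T)⁻¹ = (S.σ ^ 2)⁻¹ • (S.Gam T)⁻¹ :=
    Matrix.inv_eq_left_inv <| by
      rw [smul_mul_smul_comm, inv_mul_cancel₀ h.sq_sigma_pos.ne', one_smul,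
        Matrix.nonsing_inv_mul _ ((Matrix.isUnit_iff_isUnit_det _).1 (h.posDef_Gam T).isUnit)]
  rw [HasLineDerivAt, funext S.rate_eq]
  refine hrate.congr_deriv ?_
  simp only [zero_smul, add_zero, hinv, Matrix.smul_mul, smul_smul,
    mul_inv_cancel₀ h.sq_sigma_pos.ne', one_smul, ← Phit_eq, Matrix.mul_smul,
    Matrix.trace_smul, RCLike.smul_re]

theorem hasGradientAt_rate :
    HasGradientAt (fun t => S.rate (Function.update T n t))
      (gradient (fun t => S.rate (Function.update T n t)) (T n)) (T n) :=
  (differentiableAt_comp_update (h.differentiable_rate T)).hasGradientAt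

theorem gradient_rate_apply :
    ((gradient (fun t => S.rate (Function.update T n t)) (T n) i : ℝ) : ℂ) =
      -((S.Gam T)⁻¹ * S.partialGam T n i).trace
        + (S.partialDelta T n i : ℂ) * (S.Phit T * S.Dt).trace
        - (S.σ : ℂ) ^ 2 * (M : ℂ) * ((S.partialDelta T n i : ℂ) * (S.deltat T : ℂ)
            + (S.delta T : ℂ) * (S.partialDeltat T n i : ℂ)) := by
  have hPhit : (S.Phit T).IsHermitian :=
    S.Phit_eq T ▸ (h.posDef_one_add_delta_smul_Dt T).inv.isHermitian
  rw [gradient_comp_update_apply (h.differentiable_rate T)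
    (h.hasLineDerivAt_rate T n i),
    ← ofReal_re_trace_mul (h.posDef_Gam T).inv.isHermitian (h.isHermitian_partialGam T n i),
    ← ofReal_re_trace_mul hPhit S.posSemidef_Dt.isHermitian]
  push_cast
  rfl

end Admissible

end System

end System

end MIMOME

end

theorem proposition3 {N M : ℕ} (S : MIMOME.System N M)
    (hlam : 0 < S.lam) (hσ : 0 < S.σ) (hβ : ∀ m, 0 < S.β m) (hK : ∀ m, 0 ≤ S.K m)
    (hF : S.F ≠ 0) :
    (∀ T : MIMOME.Positions N, ∃! p : ℝ × ℝ, S.IsPositiveSolution T p) ∧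
    ∀ (T : MIMOME.Positions N) (n : Fin N),
      ∃ (dδ dδt : Fin 2 → ℝ)
        (dGam dGamt dPhi dPhit dXi dXit : Fin 2 → Matrix (Fin M) (Fin M) ℂ),
        -- the partial derivatives exist
        (∀ i : Fin 2,
          HasLineDerivAt ℝ S.delta (dδ i) T (MIMOME.coordDir n i) ∧
          HasLineDerivAt ℝ S.deltat (dδt i) T (MIMOME.coordDir n i) ∧
          MIMOME.HasMatrixPartial S.Gam (dGam i) T n i ∧
          MIMOME.HasMatrixPartial S.Gamt (dGamt i) T n i ∧
          MIMOME.HasMatrixPartial S.Phi (dPhi i) T n i ∧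
          MIMOME.HasMatrixPartial S.Phit (dPhit i) T n i ∧
          MIMOME.HasMatrixPartial S.Xi (dXi i) T n i ∧
          MIMOME.HasMatrixPartial S.Xit (dXit i) T n i ∧
          (∀ m, HasLineDerivAt ℝ (fun T' => (S.GLoS T').conjTranspose m n)
            (S.gtDeriv T n i m) T (MIMOME.coordDir n i))) ∧
        -- they satisfy the differentiated fixed-point system
        (∀ i : Fin 2,
          (dδ i : ℂ) = 1 / (M : ℂ) * (S.D * dGam i).trace ∧
          (dδt i : ℂ) = 1 / (M : ℂ) * (S.Dt * dGamt i).trace ∧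
          dGam i = -(S.Gam T * (((S.σ : ℂ) ^ 2 * (dδt i : ℂ)) • S.D + dXi i) * S.Gam T) ∧
          dGamt i = -(S.Gamt T * (((S.σ : ℂ) ^ 2 * (dδ i : ℂ)) • S.Dt + dXit i) * S.Gamt T) ∧
          dPhi i = -(S.Phi T * ((dδt i : ℂ) • S.D) * S.Phi T) ∧
          dPhit i = -(S.Phit T * ((dδ i : ℂ) • S.Dt) * S.Phit T) ∧
          dXi i = S.B T * dPhit i * (S.B T).conjTranspose
            + MIMOME.twoRe (S.sqrtLambda *
                Matrix.vecMulVec (S.gtDeriv T n i) (Pi.single n (1 : ℂ)) *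
                S.F * S.Phit T * (S.B T).conjTranspose) ∧
          dXit i = (S.B T).conjTranspose * dPhi i * S.B T
            + MIMOME.twoRe ((S.B T).conjTranspose * S.Phi T * S.sqrtLambda *
                Matrix.vecMulVec (S.gtDeriv T n i) (Pi.single n (1 : ℂ)) * S.F)) ∧
        -- the gradient of the deterministic equivalent with respect to the `n`-th position
        ∃ g : EuclideanSpace ℝ (Fin 2),
          HasGradientAt (fun t => S.rate (Function.update T n t)) g (T n) ∧
          ∀ i : Fin 2,
            (g i : ℂ) = -((S.Gam T)⁻¹ * dGam i).trace
              + (dδ i : ℂ) * (S.Phit T * S.Dt).trace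
              - (S.σ : ℂ) ^ 2 * (M : ℂ) *
                  ((dδ i : ℂ) * (S.deltat T : ℂ) + (S.delta T : ℂ) * (dδt i : ℂ)) := by
  have h : S.Admissible := ⟨hσ, hβ, hK, hF⟩
  refine ⟨h.existsUnique_isPositiveSolution, fun T n =>
    ⟨S.partialDelta T n, S.partialDeltat T n, S.partialGam T n, S.partialGamt T n,
      S.partialPhi T n, S.partialPhit T n, S.partialXi T n, S.partialXit T n, fun i => ?_,
      fun i => ?_, _, h.hasGradientAt_rate T n, h.gradient_rate_apply T n⟩⟩
  · exact ⟨h.hasLineDerivAt_delta T n i, h.hasLineDerivAt_deltat T n i,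
      .of_hasLineDerivAt (h.hasLineDerivAt_Gam T n i),
      .of_hasLineDerivAt (h.hasLineDerivAt_Gamt T n i),
      .of_hasLineDerivAt (h.hasLineDerivAt_Phi T n i),
      .of_hasLineDerivAt (h.hasLineDerivAt_Phit T n i),
      .of_hasLineDerivAt (h.hasLineDerivAt_Xi T n i),
      .of_hasLineDerivAt (h.hasLineDerivAt_Xit T n i),
      S.hasLineDerivAt_conjTranspose_GLoS_apply T n i⟩
  · exact ⟨h.partialDelta_eq T n i, h.partialDeltat_eq T n i, rfl, rfl, rfl, rfl, rfl, rfl⟩
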